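/- Notation and model. Let $d\ge 0$ be a fixed degree bound. A labeled directed graph on $n$ vertices is a directed graph $G=(V,E)$, $V=[n]$, $E\subseteq V\times V$, together with a bijection $\mathrm{num}\colon V\to[n]$; it has bounded degree if every vertex has at most $d$ in-neighbors and at most $d$ out-neighbors. The labeling $\mathrm{num}$ is a valid DFS numbering of $G$ if, for some orders of processing of the vertices in the for-loops, the following algorithm numbers every vertex $v$ with $\mathrm{num}(v)$: all vertices are undiscovered and $t=1$; for each $v\in V$, if $v$ is undiscovered, call $\mathrm{DFSVisit}(v)$; here $\mathrm{DFSVisit}(v)$ marks $v$ as discovered, gives $v$ the number $t$, increases $t$ by one and then, for each $u$ with $(v,u)\in E$, calls $\mathrm{DFSVisit}(u)$ if $u$ is undiscovered. The pair $(G,\mathrm{num})$ is $\varepsilon$-far from having a valid DFS numbering if $|E\,\triangle\,E'|>\varepsilon n$ for every directed graph $G'=(V,E')$ with all in-degrees and out-degrees at most $d$ for which $\mathrm{num}$ is a valid DFS numbering. An algorithm is given $n$, $d$, $\varepsilon$, may use randomness, and accesses $(G,\mathrm{num})$ only through an oracle that answers three types of queries: for a vertex $v$ and $1\le i\le d$,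 the $i$-th in-neighbor of $v$ (or that there is none); for a vertex $v$ and $1\le i\le d$, the $i$-th out-neighbor of $v$ (or that there is none); for a vertex $v$, its label $\mathrm{num}(v)$. The order in which the oracle lists the neighbors of a vertex is arbitrary but fixed. The query complexity is the number of oracle queries. Theorem. For every $d$ there is a constant $C=C(d)>0$ such that for every $n$ and every $0<\varepsilon<1$ there is a randomized algorithm that, with oracle access to any labeled directed graph $(G,\mathrm{num})$ on $n$ vertices with all in-degrees and out-degrees at most $d$, always performs at most $C\,n^{1/3}/\varepsilon$ queries, accepts with probability $1$ if $\mathrm{num}$ is a valid DFS numbering of $G$, and rejects with probability at least $\tfrac23$ if $(G,\mathrm{num})$ is $\varepsilon$-far from having a valid DFS numbering. -/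

import Mathlib

open scoped ENNReal symmDiff

namespace DFSTesting

/-! ### Depth-first search in directed graphs -/

/-- `l` lists every element of `s` exactly once: an order in which a for-loop over `s` may run. -/
def Enumerates {V : Type*} (l : List V) (s : Set V) : Prop :=
  l.Nodup ∧ ∀ v, v ∈ l ↔ v ∈ s

/-- The endpoints of the outgoing edges of `v`. -/
def outSet {V : Type*} (G : Digraph V) (v : V) : Set V := {u | G.Adj v u}

/-- The endpoints of the incoming edges of `v`. -/
def inSet {V : Type*} (G : Digraph V) (v : V) : Set V := {u | G.Adj u v}

/-- Big-step semantics of the for-loop "for each `u` in the list: if `u` is undiscovered, call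
`DFSVisit(u)`". The state is the list of the vertices discovered so far, in order of discovery.
`DFSLoop G l S T` says that running the loop over `l` in state `S` can end in state `T`.
In the constructor `visit`, the call `DFSVisit(u)` marks `u` as discovered (appending it gives `u`
the smallest unused number) and runs the for-loop over `out(u)`, in some order `l'`; then the
current loop goes on. -/
inductive DFSLoop {V : Type*} (G : Digraph V) : List V → List V → List V → Prop
  | done (S : List V) : DFSLoop G [] S S
  | skip {u : V} {l S T : List V} (hu : u ∈ S) (rest : DFSLoop G l S T) :
      DFSLoop G (u :: l) S T
  | visit {u : V} {l l' S S' T : List V} (hu : u ∉ S) (order : Enumerates l' (outSet G u))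
      (body : DFSLoop G l' (S ++ [u]) S') (rest : DFSLoop G l S' T) :
      DFSLoop G (u :: l) S T

/-- The numbering `num` is a DFS numbering of `G`: for some orders of processing in the for-loops,
DFS discovers the vertices in the order of their numbers. Both the vertex set `[n]` and the set
`[n]` of labels are `Fin n`, so label `i` here is label `i + 1` when counting from one. -/
def IsDFSNumbering {n : ℕ} (G : Digraph (Fin n)) (num : Equiv.Perm (Fin n)) : Prop :=
  ∃ l S : List (Fin n), Enumerates l Set.univ ∧ DFSLoop G l [] S ∧
    S.map num = List.finRange n

/-! ### Bounded-degree labeled directed graphs -/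

/-- Every vertex has at most `d` in-neighbors and at most `d` out-neighbors. -/
def DegreeAtMost {n : ℕ} (d : ℕ) (G : Digraph (Fin n)) : Prop :=
  ∀ v, (inSet G v).ncard ≤ d ∧ (outSet G v).ncard ≤ d

/-- The set of directed edges. -/
def edges {V : Type*} (G : Digraph V) : Set (V × V) := {e | G.Adj e.1 e.2}

/-- More than `ε n` edge insertions and deletions are needed to turn `G` into a directed graph of
degree at most `d` for which `num` is a DFS numbering. -/
def IsFarFromDFS {n : ℕ} (d : ℕ) (ε : ℝ) (G : Digraph (Fin n)) (num : Equiv.Perm (Fin n)) : Prop :=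
  ∀ G' : Digraph (Fin n), DegreeAtMost d G' → IsDFSNumbering G' num →
    ε * n < ((edges G ∆ edges G').ncard : ℝ)

/-! ### Oracle access -/

/-- The queries available to an algorithm; the index `i : Fin d` asks for the neighbor number
`i + 1` when counting from one. -/
inductive Query (n d : ℕ) : Type
  | inNeighbor (v : Fin n) (i : Fin d)
  | outNeighbor (v : Fin n) (i : Fin d)
  | label (v : Fin n)

/-- The type of answers to a query: a neighbor query is answered by a vertex, or by `none` if
there are fewer neighbors than asked for; a label query is answered by a label. -/
def Query.Answer {n d : ℕ} : Query n d → Type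
  | .inNeighbor _ _ => Option (Fin n)
  | .outNeighbor _ _ => Option (Fin n)
  | .label _ => Fin n

/-- The order in which an oracle lists the in-neighbors and the out-neighbors of each vertex. -/
structure NeighborOrder {n : ℕ} (G : Digraph (Fin n)) where
  inList : Fin n → List (Fin n)
  outList : Fin n → List (Fin n)
  inList_spec : ∀ v, Enumerates (inList v) (inSet G v)
  outList_spec : ∀ v, Enumerates (outList v) (outSet G v)

/-- The oracle of the graph `G` with labeling `num`. -/
def oracle {n : ℕ} (d : ℕ) {G : Digraph (Fin n)} (N : NeighborOrder G)
    (num : Equiv.Perm (Fin n)) : (q : Query n d) → q.Answer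
  | .inNeighbor v i => (N.inList v)[(i : ℕ)]?
  | .outNeighbor v i => (N.outList v)[(i : ℕ)]?
  | .label v => num v

/-- Deterministic adaptive query algorithms: output a verdict (`true` means accept), or ask a
query and continue depending on the answer. -/
inductive DecisionTree (n d : ℕ) : Type
  | output (accept : Bool) : DecisionTree n d
  | ask (q : Query n d) (next : q.Answer → DecisionTree n d) : DecisionTree n d

/-- The verdict when the queries are answered by `O`. -/
def DecisionTree.verdict {n d : ℕ} (O : (q : Query n d) → q.Answer) : DecisionTree n d → Bool
  | .output b => b
  | .ask q next => (next (O q)).verdict O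

/-- The number of queries asked when they are answered by `O`. -/
def DecisionTree.queryCount {n d : ℕ} (O : (q : Query n d) → q.Answer) : DecisionTree n d → ℕ
  | .output _ => 0
  | .ask q next => (next (O q)).queryCount O + 1

/-- A randomized query algorithm: a random choice of a deterministic one, made independently of
the input. -/
abbrev RandomizedAlgorithm (n d : ℕ) : Type := PMF (DecisionTree n d)

/-- The distribution of the verdict of a randomized algorithm with oracle `O`. -/
noncomputable def RandomizedAlgorithm.verdict {n d : ℕ} (A : RandomizedAlgorithm n d)
    (O : (q : Query n d) → q.Answer) : PMF Bool :=
  A.map (DecisionTree.verdict O)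

end DFSTesting

namespace DFSTesting

/-! DFS numberings have a local characterization (`isDFSNumbering_iff`): `num` is one exactly when
no pair `(a, b)` violates, and whether a pair violates depends only on the neighborhoods of `a` and
`b`. If sets `A` of left ends and `B` of right ends cover all violations, then O(d²)(|A| + |B|) edge
changes repair the graph (`exists_repair_of_cover`). Hence a graph that is far has no small cover,
and since the endpoints of a maximal matching form a cover, it has a matching of linearly many
violations.

Testing independent samples pairwise for this matching would need about √n samples. Walks improve on
this. From `v`, explore vertices in label order for k ≈ n^(1/3) steps and look for violations among
what has been seen. If linearly many vertices have successful walks, O(1/ε) walks suffice. Otherwise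
there is a linear matching whose left ends have failing walks, and for two such violations with left
ends at most k labels apart, exchanging the right ends in one of the two directions gives a
violation again (`Violates.exchange`). Cutting the labels into about n/k blocks, Cauchy-Schwarz
turns the matching into at least order ε²nk violations whose degrees are at most the square root of
twice their number (`exists_dense_of_exchange`). A second-moment birthday argument
(`two_thirds_le_birthday`) then finds a violation between two samples of size O(k/ε), because k³ ≥
n. The tester rejects only on an actual violation, so its error is one-sided. -/

/-- The vertex `b`, discovered while `a` still has an undiscovered out-neighbor, is not an
out-neighbor of a vertex discovered between `a` (inclusive) and `b`. -/
def Violates {n : ℕ} (G : Digraph (Fin n)) (num : Equiv.Perm (Fin n)) (a b : Fin n) : Prop :=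
  num a < num b ∧ (∃ c, G.Adj a c ∧ num b < num c) ∧
    ∀ x, G.Adj x b → num x < num b → num x < num a

/-! ### The three-point characterization of DFS numberings -/

section Characterization

variable {n : ℕ} {G : Digraph (Fin n)} {num : Equiv.Perm (Fin n)}

theorem DFSLoop.prefix {V : Type*} {G : Digraph V} {l S T : List V} (h : DFSLoop G l S T) :
    S <+: T := by
  induction h with
  | done S => exact List.prefix_refl S
  | skip _ _ ih => exact ih
  | visit _ _ _ _ ih₁ ih₂ => exact (List.prefix_append _ _).trans (ih₁.trans ih₂)

/-- Every intermediate state of the search is a prefix of the final order, so being discovered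
amounts to a threshold on the label. This lets all invariants be stated with lengths. -/
theorem mem_iff_num_lt_length {F : List (Fin n)} (hF : F.map num = List.finRange n)
    {T : List (Fin n)} (hT : T <+: F) (v : Fin n) : v ∈ T ↔ (num v : ℕ) < T.length := by
  have hlen : F.length = n := by simpa using congrArg List.length hF
  have hget : ∀ (i : ℕ) (hi : i < F.length), (num F[i] : ℕ) = i := by
    intro i hi
    have h1 : (F.map num)[i]'(by simpa using hi) = num F[i] := by simp
    rw [← h1]
    simp [hF]
  obtain ⟨R, rfl⟩ := hT
  constructor
  · intro hv
    obtain ⟨i, hi, rfl⟩ := List.getElem_of_mem hv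
    have := hget i (by simp; omega)
    rw [List.getElem_append_left hi] at this
    omega
  · intro hv
    have h2 := hget (num v) (by simp; omega)
    rw [List.getElem_append_left hv] at h2
    have h3 : T[(num v : ℕ)] = v := num.injective (Fin.ext h2)
    exact h3 ▸ List.getElem_mem hv

/-- The last clause is the absence of violations among vertices discovered by this loop. The other
three make the induction work: the listed vertices end up discovered, the new vertices have no edges
to vertices still undiscovered at the end, and each new vertex is listed or entered from an earlier
new one. -/
theorem DFSLoop.invariant {F : List (Fin n)} (hF : F.map num = List.finRange n)
    {l S T : List (Fin n)} (h : DFSLoop G l S T) (hT : T <+: F) :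
    (∀ v ∈ l, (num v : ℕ) < T.length) ∧
    (∀ u w, S.length ≤ (num u : ℕ) → (num u : ℕ) < T.length → G.Adj u w →
      (num w : ℕ) < T.length) ∧
    (∀ b, S.length ≤ (num b : ℕ) → (num b : ℕ) < T.length →
      b ∈ l ∨ ∃ x, S.length ≤ (num x : ℕ) ∧ num x < num b ∧ G.Adj x b) ∧
    (∀ a b c, S.length ≤ (num a : ℕ) → num a < num b → (num b : ℕ) < T.length →
      num b < num c → G.Adj a c → ∃ x, num a ≤ num x ∧ num x < num b ∧ G.Adj x b) := by
  induction h with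
  | done S =>
    refine ⟨by simp, ?_, ?_, ?_⟩
    · intro u w h1 h2; omega
    · intro b h1 h2; omega
    · intro a b c h1 h2 h3; have : (num a : ℕ) < num b := h2; omega
  | @skip u l S T hu rest ih =>
    obtain ⟨i1, i2, i3, i4⟩ := ih hT
    refine ⟨?_, i2, ?_, i4⟩
    · intro v hv
      rcases List.mem_cons.1 hv with rfl | hv
      · exact (mem_iff_num_lt_length hF hT v).1 (rest.prefix.subset hu)
      · exact i1 v hv
    · intro b h1 h2
      rcases i3 b h1 h2 with h | h
      · exact Or.inl (List.mem_cons_of_mem _ h)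
      · exact Or.inr h
  | @visit u l l' S S' T hu order body rest ih₁ ih₂ =>
    have hS' : S' <+: F := rest.prefix.trans hT
    have hSu : S ++ [u] <+: F := body.prefix.trans hS'
    have hS : S <+: F := (List.prefix_append _ _).trans hSu
    obtain ⟨i1, i2, i3, i4⟩ := ih₁ hS'
    obtain ⟨j1, j2, j3, j4⟩ := ih₂ hT
    -- `u` is in the prefix of length `S.length + 1` but not in the one of length `S.length`.
    have hnu : (num u : ℕ) = S.length := by
      have h1 := (mem_iff_num_lt_length hF hSu u).1 (by simp)
      have h2 := mt (mem_iff_num_lt_length hF hS u).2 hu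
      simp at h1
      omega
    have hueq : ∀ v, (num v : ℕ) = S.length → v = u := fun v hv =>
      num.injective (Fin.ext (hv.trans hnu.symm))
    have hle1 := body.prefix.length_le
    have hle2 := rest.prefix.length_le
    simp only [List.length_append, List.length_singleton] at i2 i3 i4 hle1
    refine ⟨?_, ?_, ?_, ?_⟩
    · intro v hv
      rcases List.mem_cons.1 hv with rfl | hv
      · omega
      · exact j1 v hv
    · intro v w h1 h2 h3
      by_cases hv : (num v : ℕ) < S'.length
      · by_cases hvu : v = u
        · subst hvu
          have := i1 w ((order.2 w).2 h3)
          omega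
        · have : (num v : ℕ) ≠ S.length := fun h => hvu (hueq v h)
          have := i2 v w (by omega) hv h3
          omega
      · exact j2 v w (by omega) h2 h3
    · intro b h1 h2
      by_cases hb : (num b : ℕ) < S'.length
      · by_cases hbu : b = u
        · exact Or.inl (by simp [hbu])
        · have : (num b : ℕ) ≠ S.length := fun h => hbu (hueq b h)
          rcases i3 b (by omega) hb with h | ⟨x, hx, h⟩
          · exact Or.inr ⟨u, by omega, by rw [Fin.lt_def]; omega, (order.2 b).1 h⟩
          · exact Or.inr ⟨x, by omega, h⟩
      · rcases j3 b (by omega) h2 with h | ⟨x, hx, h⟩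
        · exact Or.inl (List.mem_cons_of_mem _ h)
        · exact Or.inr ⟨x, by omega, h⟩
    · intro a b c h1 h2 h3 h4 h5
      rw [Fin.lt_def] at h2 h4
      by_cases ha : (num a : ℕ) < S'.length
      · by_cases hau : a = u
        · subst hau
          -- All out-neighbors of `a`, in particular `c`, are discovered by the end of its visit, so
          -- `b` falls within that visit and is entered from `a` or from a later vertex.
          have hc := i1 c ((order.2 c).2 h5)
          rcases i3 b (by omega) (by omega) with h | ⟨x, hx, h⟩
          · exact ⟨a, le_rfl, h2, (order.2 b).1 h⟩
          · exact ⟨x, by rw [Fin.le_def]; omega, h⟩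
        · have hne : (num a : ℕ) ≠ S.length := fun h => hau (hueq a h)
          have hc := i2 a c (by omega) ha h5
          exact i4 a b c (by omega) h2 (by omega) h4 h5
      · exact j4 a b c (by omega) h2 h3 h4 h5

theorem IsDFSNumbering.not_violates (h : IsDFSNumbering G num) (a b : Fin n) :
    ¬ Violates G num a b := by
  obtain ⟨l, S, -, hl, hS⟩ := h
  rintro ⟨h1, ⟨c, h2, h3⟩, h4⟩
  have hlen : S.length = n := by simpa using congrArg List.length hS
  obtain ⟨x, hx1, hx2, hx3⟩ :=
    (hl.invariant hS (List.prefix_refl S)).2.2.2 a b c (by simp) h1 (by omega) h3 h2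
  exact absurd (h4 x hx3 hx2) (not_lt.2 hx1)

/-- The vertices in the order of their numbers. -/
def byNumber (num : Equiv.Perm (Fin n)) : List (Fin n) := (List.finRange n).map num.symm

theorem byNumber_map : (byNumber num).map num = List.finRange n := by
  simp [byNumber, Function.comp_def]

theorem byNumber_pairwise : (byNumber num).Pairwise (fun u v => num u < num v) := by
  simp [byNumber, List.pairwise_map, List.pairwise_lt_finRange]

theorem byNumber_nodup : (byNumber num).Nodup :=
  byNumber_pairwise.imp fun h e => by simp [e] at h

theorem mem_byNumber (v : Fin n) : v ∈ byNumber num := by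
  simp only [byNumber, List.mem_map, List.mem_finRange, true_and]
  exact ⟨num v, by simp⟩

theorem length_byNumber : (byNumber num).length = n := by simp [byNumber]

theorem mem_take_byNumber {i : ℕ} (hi : i ≤ n) (v : Fin n) :
    v ∈ (byNumber num).take i ↔ (num v : ℕ) < i := by
  rw [mem_iff_num_lt_length byNumber_map (List.take_prefix i _) v]
  simp [length_byNumber, hi]

theorem take_byNumber_succ (u : Fin n) :
    (byNumber num).take (num u) ++ [u] = (byNumber num).take ((num u : ℕ) + 1) := by
  rw [List.take_succ_eq_append_getElem (by rw [length_byNumber]; exact (num u).2)]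
  simp [byNumber]

open Classical in
theorem exists_enumerates_outSet (G : Digraph (Fin n)) (num : Equiv.Perm (Fin n)) (u : Fin n) :
    ∃ l : List (Fin n), Enumerates l (outSet G u) ∧ l.Pairwise (fun u v => num u < num v) :=
  ⟨(byNumber num).filter (fun v => G.Adj u v),
    ⟨byNumber_nodup.filter _, fun v => by simp [mem_byNumber, outSet]⟩,
    byNumber_pairwise.filter _⟩

/-- Running every loop in label order reproduces the numbering. The labels in `[i, e)` are those the
loop must discover: the window is closed under out-edges, and each of its vertices is listed or has
an earlier in-neighbor inside it. The outer induction is on the window length, the inner one on the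
list. -/
theorem dfsLoop_of_not_violates (hK : ∀ a b, ¬ Violates G num a b) :
    ∀ (m : ℕ) (l : List (Fin n)) (i e : ℕ), e - i ≤ m → i ≤ e → e ≤ n →
      l.Pairwise (fun u v => num u < num v) → (∀ v ∈ l, (num v : ℕ) < e) →
      (∀ b, i ≤ (num b : ℕ) → (num b : ℕ) < e →
        b ∈ l ∨ ∃ x, i ≤ (num x : ℕ) ∧ num x < num b ∧ G.Adj x b) →
      (∀ u w, i ≤ (num u : ℕ) → (num u : ℕ) < e → G.Adj u w → (num w : ℕ) < e) →
      DFSLoop G l ((byNumber num).take i) ((byNumber num).take e) := by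
  intro m
  induction m with
  | zero =>
    intro l
    induction l with
    | nil =>
      intro i e h1 h2 h3 _ _ _ _
      obtain rfl : i = e := by omega
      exact .done _
    | cons u l ih =>
      intro i e h1 h2 h3 hp hl hb hc
      obtain rfl : i = e := by omega
      refine .skip ((mem_take_byNumber h3 u).2 (hl u (by simp))) (ih i i h1 h2 h3
        (List.pairwise_cons.1 hp).2 (fun v hv => hl v (by simp [hv])) ?_ hc)
      intro b _ _; omega
  | succ m ihm =>
    intro l
    induction l with
    | nil =>
      intro i e h1 h2 h3 _ _ hb _
      rcases h2.eq_or_lt with rfl | h2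
      · exact .done _
      · have hi : (num (num.symm ⟨i, by omega⟩) : ℕ) = i := by simp
        rcases hb (num.symm ⟨i, by omega⟩) (by omega) (by omega) with h | ⟨x, hx, hx', -⟩
        · simp at h
        · rw [Fin.lt_def] at hx'; omega
    | cons u l ih =>
      intro i e h1 h2 h3 hp hl hb hc
      have hp' := List.pairwise_cons.1 hp
      by_cases hu : (num u : ℕ) < i
      · refine .skip ((mem_take_byNumber (by omega) u).2 hu) (ih i e h1 h2 h3
          hp'.2 (fun v hv => hl v (by simp [hv])) ?_ hc)
        intro b hb1 hb2
        rcases hb b hb1 hb2 with h | h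
        · rcases List.mem_cons.1 h with rfl | h
          · omega
          · exact Or.inl h
        · exact Or.inr h
      · have hue := hl u (by simp)
        -- The vertex labeled `i` has no earlier in-neighbor in the window, so it is listed; the
        -- list is sorted and `u` is its head.
        have hui : (num u : ℕ) = i := by
          have hi : (num (num.symm ⟨i, by omega⟩) : ℕ) = i := by simp
          rcases hb (num.symm ⟨i, by omega⟩) (by omega) (by omega) with h | ⟨x, hx, hx', -⟩
          · rcases List.mem_cons.1 h with h | h
            · rw [h] at hi; exact hi
            · have := hp'.1 _ h
              rw [Fin.lt_def] at this
              omega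
          · rw [Fin.lt_def] at hx'; omega
        subst hui
        -- The visit of `u` discovers the shortest window starting at `u` that is closed under
        -- out-edges.
        have hex : ∃ e', (num u : ℕ) < e' ∧ ∀ v w, (num u : ℕ) ≤ (num v : ℕ) →
            (num v : ℕ) < e' → G.Adj v w → (num w : ℕ) < e' := ⟨e, hue, hc⟩
        classical
        obtain ⟨hs1, hs2⟩ := Nat.find_spec hex
        have hse : Nat.find hex ≤ e := Nat.find_min' hex ⟨hue, hc⟩
        have hmin := fun b => Nat.find_min (m := b) hex
        set e' := Nat.find hex
        obtain ⟨l', hl', hp''⟩ := exists_enumerates_outSet G num u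
        refine .visit (l' := l') (S' := (byNumber num).take e')
          (fun h => lt_irrefl _ ((mem_take_byNumber (by omega) u).1 h)) hl' ?_ ?_
        · rw [take_byNumber_succ]
          refine ihm l' _ _ (by omega) (by omega) (by omega) hp'' ?_ ?_ ?_
          · intro v hv
            exact hs2 u v le_rfl hs1 ((hl'.2 v).1 hv)
          · intro b hb1 hb2
            -- By minimality of `e'`, cutting the window before `b` breaks closure: some edge `a →
            -- c` jumps to or over `b`. As `(a, b)` does not violate, `b` has an in-neighbor in `[a,
            -- b)`.
            have hnot := hmin (num b) hb2
            push Not at hnot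
            obtain ⟨a, c, ha1, ha2, ha3, ha4⟩ := hnot (by omega)
            have key : ∃ x, num a ≤ num x ∧ num x < num b ∧ G.Adj x b := by
              by_cases hcb : c = b
              · exact ⟨a, le_rfl, ha2, hcb ▸ ha3⟩
              · by_contra hcon
                push Not at hcon
                refine hK a b ⟨ha2, ⟨c, ha3, lt_of_le_of_ne ha4 ?_⟩, ?_⟩
                · exact fun h => hcb (num.injective h.symm)
                · intro x hx1 hx2
                  by_contra hlt
                  exact hcon x (not_lt.1 hlt) hx2 hx1
            obtain ⟨x, hx1, hx2, hx3⟩ := key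
            rw [Fin.le_def] at hx1
            by_cases hxu : x = u
            · exact Or.inl ((hl'.2 b).2 (hxu ▸ hx3))
            · have : (num x : ℕ) ≠ num u := fun h => hxu (num.injective (Fin.ext h))
              exact Or.inr ⟨x, by omega, hx2, hx3⟩
          · intro v w hv1 hv2 hvw
            exact hs2 v w (by omega) hv2 hvw
        · refine ihm l _ _ (by omega) hse h3 hp'.2 (fun v hv => hl v (by simp [hv])) ?_ ?_
          · intro b hb1 hb2
            rcases hb b (by omega) hb2 with h | ⟨x, hx1, hx2, hx3⟩
            · rcases List.mem_cons.1 h with rfl | h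
              · omega
              · exact Or.inl h
            · by_cases hxe : (num x : ℕ) < e'
              · have := hs2 x b hx1 hxe hx3
                omega
              · exact Or.inr ⟨x, by omega, hx2, hx3⟩
          · intro v w hv1 hv2 hvw
            exact hc v w (by omega) hv2 hvw

/-- The three-point characterization of depth-first search numberings. -/
theorem isDFSNumbering_iff : IsDFSNumbering G num ↔ ∀ a b, ¬ Violates G num a b := by
  refine ⟨IsDFSNumbering.not_violates, fun hK => ?_⟩
  refine ⟨byNumber num, byNumber num, ⟨byNumber_nodup, fun v => by simp [mem_byNumber]⟩, ?_,
    byNumber_map⟩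
  have := dfsLoop_of_not_violates hK n (byNumber num) 0 n (by omega) (by omega) le_rfl
    byNumber_pairwise (fun v _ => (num v).2) (fun b _ _ => Or.inl (mem_byNumber b))
    (fun _ w _ _ _ => (num w).2)
  rwa [List.take_zero, List.take_of_length_le (by rw [length_byNumber])] at this

end Characterization

/-! ### Repairing a graph whose violations have a small cover -/

section Repair

variable {n d : ℕ} {G : Digraph (Fin n)} {num : Equiv.Perm (Fin n)}

theorem ncard_symmDiff_triangle {α : Type*} [Finite α] (A B C : Set α) :
    (A ∆ C).ncard ≤ (A ∆ B).ncard + (B ∆ C).ncard :=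
  (Set.ncard_le_ncard (symmDiff_triangle A B C) (Set.toFinite _)).trans (Set.ncard_union_le _ _)

/-- Make `o` an out-neighbor of `x`, after deleting all edges into `o` and all edges from `x` to
vertices whose number is not larger. -/
def attach (G : Digraph (Fin n)) (num : Equiv.Perm (Fin n)) (x o : Fin n) : Digraph (Fin n) where
  Adj u v := (G.Adj u v ∧ v ≠ o ∧ ¬(u = x ∧ num v ≤ num x)) ∨ (u = x ∧ v = o)

/-- After the change `o` has the single in-neighbor `x`, which is where `0 < d` enters. The
hypothesis `room` says that `x` has a free out-slot, frees one by losing a backward edge or loop, or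
already points to `o`. -/
theorem attach_degreeAtMost (hd : 0 < d) (hG : DegreeAtMost d G) {x o : Fin n}
    (room : (outSet G x).ncard < d ∨ (∃ z, G.Adj x z ∧ num z ≤ num x) ∨ G.Adj x o) :
    DegreeAtMost d (attach G num x o) := by
  intro v
  constructor
  · by_cases hv : v = o
    · have : inSet (attach G num x o) v ⊆ {x} := by
        rintro u (⟨-, h, -⟩ | ⟨h, -⟩)
        · exact absurd hv h
        · exact h
      have h2 := Set.ncard_le_ncard this (Set.toFinite _)
      rw [Set.ncard_singleton] at h2
      omega
    · refine (Set.ncard_le_ncard ?_ (Set.toFinite _)).trans (hG v).1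
      rintro u (⟨h, -, -⟩ | ⟨-, h⟩)
      · exact h
      · exact absurd h hv
  · by_cases hv : v = x
    · subst hv
      have hsub : outSet (attach G num v o) v ⊆ insert o {z ∈ outSet G v | ¬ num z ≤ num v} := by
        rintro z (⟨h1, -, h2⟩ | ⟨-, h⟩)
        · exact Or.inr ⟨h1, fun h => h2 ⟨rfl, h⟩⟩
        · exact Or.inl h
      have hcard := (Set.ncard_le_ncard hsub (Set.toFinite _)).trans (Set.ncard_insert_le _ _)
      rcases room with h | ⟨z, hz1, hz2⟩ | h
      · have := Set.ncard_le_ncard (s := {z ∈ outSet G v | ¬ num z ≤ num v}) (t := outSet G v)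
          (fun _ h => h.1) (Set.toFinite _)
        omega
      · have : {z ∈ outSet G v | ¬ num z ≤ num v} ⊂ outSet G v :=
          ⟨fun _ h => h.1, fun h => (h (show z ∈ outSet G v from hz1)).2 hz2⟩
        have := Set.ncard_lt_ncard this (Set.toFinite _)
        have := (hG v).2
        omega
      · refine (Set.ncard_le_ncard ?_ (Set.toFinite _)).trans (hG v).2
        rintro z (⟨h1, -, -⟩ | ⟨-, rfl⟩)
        · exact h1
        · exact h
    · refine (Set.ncard_le_ncard ?_ (Set.toFinite _)).trans (hG v).2
      rintro z (⟨h, -, -⟩ | ⟨h, -⟩)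
      · exact h
      · exact absurd h hv

theorem attach_symmDiff (hG : DegreeAtMost d G) (x o : Fin n) :
    (edges G ∆ edges (attach G num x o)).ncard ≤ 2 * d + 1 := by
  have hsub : edges G ∆ edges (attach G num x o) ⊆
      ((fun u => (u, o)) '' inSet G o ∪ (fun v => (x, v)) '' outSet G x) ∪ {(x, o)} := by
    rintro ⟨u, v⟩ (⟨h1, h2⟩ | ⟨h1, h2⟩)
    · left
      have h1 : G.Adj u v := h1
      by_cases hv : v = o
      · subst hv
        exact Or.inl ⟨u, h1, rfl⟩
      · by_cases hu : u = x
        · subst hu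
          exact Or.inr ⟨v, h1, rfl⟩
        · exact absurd (Or.inl ⟨h1, hv, fun h => hu h.1⟩) h2
    · right
      rcases h1 with ⟨h1, -⟩ | ⟨h3, h4⟩
      · exact absurd h1 h2
      · exact Prod.ext h3 h4
  have h1 := Set.ncard_le_ncard hsub (Set.toFinite _)
  have h2 := Set.ncard_union_le ((fun u => (u, o)) '' inSet G o ∪ (fun v => (x, v)) '' outSet G x)
    {(x, o)}
  have h3 := Set.ncard_union_le ((fun u => (u, o)) '' inSet G o) ((fun v => (x, v)) '' outSet G x)
  have h4 := Set.ncard_image_le (f := fun u => (u, o)) (Set.toFinite (inSet G o))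
  have h5 := Set.ncard_image_le (f := fun v => (x, v)) (Set.toFinite (outSet G x))
  rw [Set.ncard_singleton] at h2
  have := hG o
  have := hG x
  omega

theorem attach_not_violates {x o : Fin n} (hx : (num o : ℕ) = num x + 1) (a : Fin n) :
    ¬ Violates (attach G num x o) num a o := by
  rintro ⟨h1, -, h3⟩
  have := h3 x (Or.inr ⟨rfl, rfl⟩) (by rw [Fin.lt_def]; omega)
  rw [Fin.lt_def] at h1 this
  omega

/-- No new violations arise at other vertices: the edges lost enter `o` or do not increase the
label, so they never served to excuse `b`, and the new edge joins consecutive labels, so it jumps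
over nothing. -/
theorem Violates.of_attach {x o a b : Fin n} (hx : (num o : ℕ) = num x + 1) (hb : b ≠ o)
    (h : Violates (attach G num x o) num a b) : Violates G num a b := by
  obtain ⟨h1, ⟨c, hc, h2⟩, h3⟩ := h
  refine ⟨h1, ⟨c, ?_, h2⟩, ?_⟩
  · rcases hc with hc | ⟨rfl, rfl⟩
    · exact hc.1
    · rw [Fin.lt_def] at h1 h2
      omega
  · intro y hy hlt
    refine h3 y (Or.inl ⟨hy, hb, ?_⟩) hlt
    rintro ⟨rfl, h⟩
    exact absurd hlt (not_lt.2 h)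

theorem attach_adj_of_ne {x o y z : Fin n} (hy : y ≠ x) (h : (attach G num x o).Adj y z) :
    G.Adj y z := by
  rcases h with h | h
  · exact h.1
  · exact absurd h.1 hy

/-- Delete one edge. -/
def deleteEdge (G : Digraph (Fin n)) (x c : Fin n) : Digraph (Fin n) where
  Adj u v := G.Adj u v ∧ ¬(u = x ∧ v = c)

theorem exists_pred {o : Fin n} (ho : 0 < (num o : ℕ)) : ∃ x, (num o : ℕ) = num x + 1 :=
  ⟨num.symm ⟨num o - 1, by omega⟩, by simp; omega⟩

/-- If `o` is the only vertex that need not be consistent apart from those in `O`, then a bounded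
number of edge modifications makes it consistent. -/
theorem exists_repair_vertex (hd : 0 < d) (hG : DegreeAtMost d G) (O : Set (Fin n)) (o : Fin n)
    (hO : ∀ a b, Violates G num a b → b = o ∨ b ∈ O) :
    ∃ G' : Digraph (Fin n), DegreeAtMost d G' ∧ (edges G ∆ edges G').ncard ≤ 4 * d + 3 ∧
      ∀ a b, Violates G' num a b → b ∈ O := by
  rcases Nat.eq_zero_or_pos (num o : ℕ) with h0 | h0
  · refine ⟨G, hG, by simp, fun a b h => ?_⟩
    rcases hO a b h with rfl | h'
    · have := h.1
      rw [Fin.lt_def] at this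
      omega
    · exact h'
  obtain ⟨x, hx⟩ := exists_pred h0
  have key : ∀ H : Digraph (Fin n), (∀ a b, Violates H num a b → b = o ∨ b ∈ O) →
      ∀ a b, Violates (attach H num x o) num a b → b ∈ O := by
    intro H hH a b h
    by_cases hb : b = o
    · subst hb
      exact absurd h (attach_not_violates hx a)
    · exact (hH a b (h.of_attach hx hb)).resolve_left hb
  by_cases room : (outSet G x).ncard < d ∨ (∃ z, G.Adj x z ∧ num z ≤ num x) ∨ G.Adj x o
  · exact ⟨attach G num x o, attach_degreeAtMost hd hG room,
      (attach_symmDiff hG x o).trans (by omega), key G hO⟩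
  push Not at room
  obtain ⟨r1, r2, r3⟩ := room
  -- Without room, all `d` out-edges of `x` jump strictly over `o`. One of them, `x → c`, is
  -- sacrificed; only `c` can become newly inconsistent.
  obtain ⟨c, hc⟩ : (outSet G x).Nonempty := by
    rw [← Set.ncard_pos (Set.toFinite _)]
    omega
  have hco : c ≠ o := fun h => r3 (h ▸ hc)
  have hxc := r2 c hc
  have hoc : (num o : ℕ) < num c := by
    have : (num c : ℕ) ≠ num o := fun h => hco (num.injective (Fin.ext h))
    rw [Fin.lt_def] at hxc
    omega
  set G₁ := deleteEdge G x c with hG₁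
  have hsub : ∀ u v, G₁.Adj u v → G.Adj u v := fun u v h => h.1
  have hG₁deg : DegreeAtMost d G₁ := fun v =>
    ⟨(Set.ncard_le_ncard (fun u h => hsub u v h) (Set.toFinite _)).trans (hG v).1,
      (Set.ncard_le_ncard (fun u h => hsub v u h) (Set.toFinite _)).trans (hG v).2⟩
  have hout : (outSet G₁ x).ncard < d := by
    refine lt_of_lt_of_le (Set.ncard_lt_ncard ?_ (Set.toFinite _)) (hG x).2
    exact ⟨fun u h => hsub x u h, fun h => (h hc).2 ⟨rfl, rfl⟩⟩
  have hviol : ∀ a b, b ≠ c → Violates G₁ num a b → Violates G num a b := by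
    rintro a b hb ⟨h1, ⟨e, he, h2⟩, h3⟩
    exact ⟨h1, ⟨e, he.1, h2⟩, fun y hy => h3 y ⟨hy, fun h => hb h.2⟩⟩
  have hdiff : (edges G ∆ edges G₁).ncard ≤ 1 := by
    rw [← Set.ncard_singleton (x, c)]
    refine Set.ncard_le_ncard ?_ (Set.toFinite _)
    rintro ⟨u, v⟩ (⟨h1, h2⟩ | ⟨h1, h2⟩)
    · by_contra hne
      exact h2 ⟨h1, fun h => hne (Prod.ext h.1 h.2)⟩
    · exact absurd h1.1 h2
  obtain ⟨G₂, hG₂deg, hG₂diff, hG₂viol, hG₂out⟩ : ∃ G₂ : Digraph (Fin n), DegreeAtMost d G₂ ∧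
      (edges G₁ ∆ edges G₂).ncard ≤ 2 * d + 1 ∧
      (∀ a b, Violates G₂ num a b → b = o ∨ b ∈ O) ∧ ∀ z, G₂.Adj x z → G₁.Adj x z := by
    by_cases hcO : c ∈ O
    · refine ⟨G₁, hG₁deg, by simp, fun a b h => ?_, fun _ h => h⟩
      by_cases hb : b = c
      · exact Or.inr (hb ▸ hcO)
      · exact hO a b (hviol a b hb h)
    · obtain ⟨y, hy⟩ := exists_pred (num := num) (o := c) (by omega)
      have hyx : y ≠ x := by rintro rfl; omega
      -- `c` is reattached to its label predecessor `y`. If `y` had no room either, its out-edges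
      -- would all jump over `c`, so `(y, c)` would already violate in `G`, although `c` is neither
      -- `o` nor in `O`.
      have hroom : (outSet G₁ y).ncard < d ∨ (∃ z, G₁.Adj y z ∧ num z ≤ num y) ∨
          G₁.Adj y c := by
        by_contra hcon
        push Not at hcon
        obtain ⟨s1, s2, s3⟩ := hcon
        obtain ⟨e, he⟩ : (outSet G₁ y).Nonempty := by
          rw [← Set.ncard_pos (Set.toFinite _)]
          omega
        have hye := s2 e he
        have hec : e ≠ c := fun h => s3 (h ▸ he)
        have hce : (num c : ℕ) < num e := by
          have : (num e : ℕ) ≠ num c := fun h => hec (num.injective (Fin.ext h))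
          rw [Fin.lt_def] at hye
          omega
        have hv : Violates G num y c := by
          refine ⟨by rw [Fin.lt_def]; omega, ⟨e, he.1, hce⟩, fun w hw hlt => ?_⟩
          have hwy : w ≠ y := fun h => s3 ⟨h ▸ hw, fun h => hyx h.1⟩
          have : (num w : ℕ) ≠ num y := fun h => hwy (num.injective (Fin.ext h))
          rw [Fin.lt_def] at hlt ⊢
          omega
        exact (hO y c hv).elim hco hcO
      refine ⟨attach G₁ num y c, attach_degreeAtMost hd hG₁deg hroom,
        attach_symmDiff hG₁deg y c, fun a b h => ?_, fun z h => attach_adj_of_ne hyx.symm h⟩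
      by_cases hb : b = c
      · subst hb
        exact absurd h (attach_not_violates hy a)
      · exact hO a b (hviol a b hb (h.of_attach hy hb))
  have hroom₂ : (outSet G₂ x).ncard < d :=
    (Set.ncard_le_ncard (fun z h => hG₂out z h) (Set.toFinite _)).trans_lt hout
  refine ⟨attach G₂ num x o, attach_degreeAtMost hd hG₂deg (Or.inl hroom₂), ?_, key G₂ hG₂viol⟩
  have t1 := ncard_symmDiff_triangle (edges G) (edges G₁) (edges (attach G₂ num x o))
  have t2 := ncard_symmDiff_triangle (edges G₁) (edges G₂) (edges (attach G₂ num x o))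
  have t3 := attach_symmDiff (num := num) hG₂deg x o
  omega

theorem exists_repair_of_inconsistent (hd : 0 < d) (O : Finset (Fin n)) :
    ∀ G : Digraph (Fin n), DegreeAtMost d G → (∀ a b, Violates G num a b → b ∈ O) →
    ∃ G' : Digraph (Fin n), DegreeAtMost d G' ∧ IsDFSNumbering G' num ∧
      (edges G ∆ edges G').ncard ≤ (4 * d + 3) * O.card := by
  classical
  induction O using Finset.induction_on with
  | empty =>
    intro G hG h
    exact ⟨G, hG, isDFSNumbering_iff.2 fun a b hab => by simpa using h a b hab, by simp⟩
  | insert o O ho ih =>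
    intro G hG h
    obtain ⟨G₁, h1, h2, h3⟩ := exists_repair_vertex hd hG (O : Set (Fin n)) o
      (fun a b hab => by simpa using h a b hab)
    obtain ⟨G', h4, h5, h6⟩ := ih G₁ h1 (fun a b hab => by simpa using h3 a b hab)
    refine ⟨G', h4, h5, ?_⟩
    have := ncard_symmDiff_triangle (edges G) (edges G₁) (edges G')
    rw [Finset.card_insert_of_notMem ho]
    linarith

/-- A vertex cover of the violations bounds the distance to having a DFS numbering. -/
theorem exists_repair_of_cover (hG : DegreeAtMost d G) (A B : Finset (Fin n))
    (hAB : ∀ a b, Violates G num a b → a ∈ A ∨ b ∈ B) :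
    ∃ G' : Digraph (Fin n), DegreeAtMost d G' ∧ IsDFSNumbering G' num ∧
      (edges G ∆ edges G').ncard ≤ 4 * (d + 1) ^ 2 * (A.card + B.card) := by
  classical
  rcases Nat.eq_zero_or_pos d with rfl | hd
  · refine ⟨G, hG, isDFSNumbering_iff.2 ?_, by simp⟩
    rintro a b ⟨-, ⟨c, hc, -⟩, -⟩
    have h1 := (hG a).2
    rw [Nat.le_zero, Set.ncard_eq_zero (Set.toFinite _)] at h1
    have : c ∈ outSet G a := hc
    simp [h1] at this
  -- Without out-edges a vertex of `A` is never the left end of a violation. The deletion makes only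
  -- heads of deleted edges newly inconsistent, at most `d * A.card` of them; these are repaired
  -- along with `B`.
  let G₁ : Digraph (Fin n) := ⟨fun u v => G.Adj u v ∧ u ∉ A⟩
  have hG₁deg : DegreeAtMost d G₁ := fun v =>
    ⟨(Set.ncard_le_ncard (fun u h => h.1) (Set.toFinite _)).trans (hG v).1,
      (Set.ncard_le_ncard (fun u h => h.1) (Set.toFinite _)).trans (hG v).2⟩
  let R : Finset (Fin n × Fin n) := A.biUnion fun a => (outSet G a).toFinset.image fun c => (a, c)
  have hRcard : R.card ≤ A.card * d := by
    refine Finset.card_biUnion_le_card_mul _ _ _ fun a _ => Finset.card_image_le.trans ?_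
    rw [← Set.ncard_eq_toFinset_card']
    exact (hG a).2
  have hR : ∀ u v, u ∈ A → G.Adj u v → (u, v) ∈ R := by
    intro u v hu h
    refine Finset.mem_biUnion.2 ⟨u, hu, Finset.mem_image.2 ⟨v, ?_, rfl⟩⟩
    exact Set.mem_toFinset.2 h
  have hdiff : (edges G ∆ edges G₁).ncard ≤ R.card := by
    rw [← Set.ncard_coe_finset]
    refine Set.ncard_le_ncard ?_ (Set.toFinite _)
    rintro ⟨u, v⟩ (⟨h1, h2⟩ | ⟨h1, h2⟩)
    · exact hR u v (by by_contra hu; exact h2 ⟨h1, hu⟩) h1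
    · exact absurd h1.1 h2
  obtain ⟨G', h1, h2, h3⟩ := exists_repair_of_inconsistent (num := num) hd (B ∪ R.image Prod.snd)
    G₁ hG₁deg (by
      rintro a b ⟨v1, ⟨c, hc, v2⟩, v3⟩
      rw [Finset.mem_union]
      by_contra hcon
      push Not at hcon
      refine (hAB a b ⟨v1, ⟨c, hc.1, v2⟩, fun x hx => v3 x ⟨hx, fun hxA => ?_⟩⟩).elim hc.2 hcon.1
      exact hcon.2 (Finset.mem_image.2 ⟨(x, b), hR x b hxA hx, rfl⟩))
  refine ⟨G', h1, h2, ?_⟩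
  have t1 := ncard_symmDiff_triangle (edges G) (edges G₁) (edges G')
  have t2 : (B ∪ R.image Prod.snd).card ≤ B.card + A.card * d :=
    (Finset.card_union_le _ _).trans (Nat.add_le_add_left (Finset.card_image_le.trans hRcard) _)
  have t3 := Nat.mul_le_mul_left (4 * d + 3) t2
  nlinarith [Nat.zero_le (A.card * d), Nat.zero_le A.card, Nat.zero_le (B.card * d),
    Nat.zero_le (B.card * d ^ 2), Nat.zero_le B.card]

end Repair

/-! ### Second-moment estimates for uniform samples -/

section Sampling

open Finset BigOperators

variable {α β Ω : Type*} [Fintype α] [Fintype β] [Fintype Ω]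

theorem expect_prod (f : α × β → ℝ) : 𝔼 x, f x = 𝔼 a, 𝔼 b, f (a, b) := by
  rw [← univ_product_univ, expect_product]

theorem expect_fin_succ {q : ℕ} (f : (Fin (q + 1) → α) → ℝ) :
    𝔼 x, f x = 𝔼 a, 𝔼 y : Fin q → α, f (Fin.cons a y) := by
  rw [← expect_prod (fun p : α × (Fin q → α) => f (Fin.cons p.1 p.2))]
  exact (Fintype.expect_equiv (Fin.consEquiv fun _ => α) _ _ fun _ => rfl).symm

theorem expect_sum_samples [Nonempty α] (q : ℕ) (g : α → ℝ) :
    𝔼 x : Fin q → α, ∑ i, g (x i) = q * 𝔼 a, g a := by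
  induction q with
  | zero => simp
  | succ q ih =>
    simp only [expect_fin_succ, Fin.sum_univ_succ, Fin.cons_zero, Fin.cons_succ,
      expect_add_distrib, ih, Fintype.expect_const]
    push_cast
    ring

theorem expect_sum_samples_sq [Nonempty α] (q : ℕ) (g : α → ℝ) :
    𝔼 x : Fin q → α, (∑ i, g (x i)) ^ 2 =
      q * 𝔼 a, g a ^ 2 + q * (q - 1) * (𝔼 a, g a) ^ 2 := by
  induction q with
  | zero => simp
  | succ q ih =>
    have h : ∀ (a : α) (y : Fin q → α), (g a + ∑ i, g (y i)) ^ 2 =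
        g a ^ 2 + (2 * g a) * ∑ i, g (y i) + (∑ i, g (y i)) ^ 2 := fun a y => by ring
    simp only [expect_fin_succ, Fin.sum_univ_succ, Fin.cons_zero, Fin.cons_succ, h,
      expect_add_distrib, ih, Fintype.expect_const, ← mul_expect, expect_sum_samples,
      ← expect_mul]
    push_cast
    ring

theorem expect_sum_samples_sq_le [Nonempty α] (q : ℕ) (g : α → ℝ) :
    𝔼 x : Fin q → α, (∑ i, g (x i)) ^ 2 ≤ q * 𝔼 a, g a ^ 2 + q ^ 2 * (𝔼 a, g a) ^ 2 := by
  rw [expect_sum_samples_sq]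
  nlinarith [mul_nonneg (Nat.cast_nonneg (α := ℝ) q) (sq_nonneg (𝔼 a, g a))]

/-- Pointwise, 1 - (X/μ - 1)² bounds the indicator of `P` from below: it is at most 1 and vanishes
where X = 0. Its mean is 2 - E[X²]/μ² ≥ 2 - 4/3. -/
theorem two_thirds_le_expect [Nonempty Ω] {X : Ω → ℝ} {μ : ℝ} (hμ : 0 < μ) (h₁ : 𝔼 ω, X ω = μ)
    (h₂ : 3 * 𝔼 ω, X ω ^ 2 ≤ 4 * μ ^ 2) (P : Ω → Prop) [DecidablePred P]
    (hP : ∀ ω, X ω ≠ 0 → P ω) : (2 / 3 : ℝ) ≤ 𝔼 ω, if P ω then (1 : ℝ) else 0 := by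
  have h : ∀ ω, 2 / μ * X ω - 1 / μ ^ 2 * X ω ^ 2 ≤ if P ω then (1 : ℝ) else 0 := by
    intro ω
    split_ifs with hω
    · have : 1 - (2 / μ * X ω - 1 / μ ^ 2 * X ω ^ 2) = (X ω / μ - 1) ^ 2 := by
        field_simp
        ring
      nlinarith [sq_nonneg (X ω / μ - 1)]
    · have : X ω = 0 := by
        by_contra h
        exact hω (hP ω h)
      simp [this]
  refine le_trans ?_ (expect_le_expect fun ω _ => h ω)
  rw [expect_sub_distrib, ← mul_expect, ← mul_expect, h₁]
  have e1 : 2 / μ * μ = 2 := by field_simp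
  have e2 : 1 / μ ^ 2 * 𝔼 ω, X ω ^ 2 ≤ 4 / 3 := by
    rw [one_div, inv_mul_le_iff₀ (by positivity)]
    linarith
  linarith

/-- A set of density `p` is hit by a sample of size at least `3 / p`. -/
theorem two_thirds_le_hit [Nonempty α] (W : Finset α) (r : ℕ)
    (hr : 3 * (Fintype.card α : ℝ) ≤ r * W.card) (P : (Fin r → α) → Prop) [DecidablePred P]
    (hP : ∀ x i, x i ∈ W → P x) : (2 / 3 : ℝ) ≤ 𝔼 x, if P x then (1 : ℝ) else 0 := by
  classical
  have hα : (0 : ℝ) < Fintype.card α := by exact_mod_cast Fintype.card_pos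
  let g : α → ℝ := fun a => if a ∈ W then 1 else 0
  have hg : 𝔼 a, g a = W.card / Fintype.card α := by
    rw [Fintype.expect_eq_sum_div_card]
    simp [g]
  have hg2 : 𝔼 a, g a ^ 2 = 𝔼 a, g a := expect_congr rfl fun a _ => by simp [g]
  -- With mean m ≥ 3, the second moment is at most m + m² ≤ (4/3)m².
  have hμ : 3 ≤ r * 𝔼 a, g a := by
    rw [hg, mul_div_assoc', le_div_iff₀ hα]
    exact hr
  have hμ0 : 0 < r * 𝔼 a, g a := by linarith
  have main := two_thirds_le_expect (X := fun x : Fin r → α => ∑ i, g (x i)) hμ0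
    (expect_sum_samples r g)
  refine main ?_ P ?_
  · have h := expect_sum_samples_sq_le r g
    rw [hg2, ← mul_pow] at h
    generalize (r : ℝ) * 𝔼 a, g a = m at h hμ ⊢
    nlinarith
  · intro x hx
    obtain ⟨i, -, hi⟩ := exists_ne_zero_of_sum_ne_zero hx
    refine hP x i ?_
    by_contra h
    simp [g, h] at hi

/-- The birthday argument: if the bipartite graph `F` has degrees at most `D`, where `D ^ 2` is at
most twice the number of edges, then two samples of size `q` contain an edge. -/
theorem two_thirds_le_birthday [Nonempty α] [DecidableEq α] (F : Finset (α × α)) (D q : ℕ)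
    (h₁ : ∀ a, (F.filter fun e => e.1 = a).card ≤ D)
    (h₂ : ∀ b, (F.filter fun e => e.2 = b).card ≤ D)
    (hD : D ^ 2 ≤ 2 * F.card) (hq : 100 * (Fintype.card α : ℝ) ^ 2 ≤ (q : ℝ) ^ 2 * F.card)
    (P : (Fin q → α) × (Fin q → α) → Prop) [DecidablePred P]
    (hP : ∀ x i j, (x.1 i, x.2 j) ∈ F → P x) :
    (2 / 3 : ℝ) ≤ 𝔼 x, if P x then (1 : ℝ) else 0 := by
  obtain ⟨N, hN⟩ : ∃ N : ℝ, N = Fintype.card α := ⟨_, rfl⟩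
  rw [← hN] at hq
  have hN0 : 0 < N := by rw [hN]; exact_mod_cast Fintype.card_pos
  let f : α → α → ℝ := fun a b => if (a, b) ∈ F then 1 else 0
  have hf2 : ∀ a b, f a b ^ 2 = f a b := fun a b => by simp [f]
  set p : ℝ := F.card / N ^ 2 with hp
  have hfp : 𝔼 a, 𝔼 b, f a b = p := by
    rw [← expect_prod (fun x : α × α => f x.1 x.2), Fintype.expect_eq_sum_div_card]
    simp [f, hp, hN, sq]
  have hfp' : 𝔼 b, 𝔼 a, f a b = p := by rw [expect_comm, hfp]
  have hrow : ∀ a, 𝔼 b, f a b ≤ D / N := by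
    intro a
    rw [Fintype.expect_eq_sum_div_card, ← hN]
    have : ∑ b, f a b = ((F.filter fun e => e.1 = a).card : ℝ) := by
      simp only [f, sum_boole]
      congr 1
      refine card_bij' (fun b _ => (a, b)) (fun e _ => e.2) ?_ ?_ ?_ ?_
      · intro b hb; simpa using hb
      · rintro ⟨u, v⟩ hb
        obtain ⟨hb, rfl⟩ := mem_filter.1 hb
        simpa using hb
      · intro b hb; rfl
      · rintro ⟨u, v⟩ hb
        obtain ⟨hb, rfl⟩ := mem_filter.1 hb
        rfl
    rw [this]
    have := h₁ a
    gcongr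
  have hcol : ∀ b, 𝔼 a, f a b ≤ D / N := by
    intro b
    rw [Fintype.expect_eq_sum_div_card, ← hN]
    have : ∑ a, f a b = ((F.filter fun e => e.2 = b).card : ℝ) := by
      simp only [f, sum_boole]
      congr 1
      refine card_bij' (fun a _ => (a, b)) (fun e _ => e.1) ?_ ?_ ?_ ?_
      · intro a ha; simpa using ha
      · rintro ⟨u, v⟩ hb
        obtain ⟨hb, rfl⟩ := mem_filter.1 hb
        simpa using hb
      · intro b hb; rfl
      · rintro ⟨u, v⟩ hb
        obtain ⟨hb, rfl⟩ := mem_filter.1 hb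
        rfl
    rw [this]
    have := h₂ b
    gcongr
  have hf0 : ∀ a b, 0 ≤ f a b := fun a b => by simp only [f]; split_ifs <;> norm_num
  have hrow2 : 𝔼 a, (𝔼 b, f a b) ^ 2 ≤ D / N * p := by
    rw [← hfp, mul_expect]
    refine expect_le_expect fun a _ => ?_
    rw [sq]
    exact mul_le_mul_of_nonneg_right (hrow a) (expect_nonneg fun b _ => hf0 a b)
  have hcol2 : 𝔼 b, (𝔼 a, f a b) ^ 2 ≤ D / N * p := by
    rw [← hfp', mul_expect]
    refine expect_le_expect fun b _ => ?_
    rw [sq]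
    exact mul_le_mul_of_nonneg_right (hcol b) (expect_nonneg fun a _ => hf0 a b)
  let X : (Fin q → α) × (Fin q → α) → ℝ := fun x => ∑ j, ∑ i, f (x.1 i) (x.2 j)
  have hX : 𝔼 x, X x = q ^ 2 * p := by
    rw [expect_prod]
    have : ∀ x : Fin q → α, 𝔼 y : Fin q → α, X (x, y) = q * 𝔼 b, ∑ i, f (x i) b := fun x =>
      expect_sum_samples q (fun b => ∑ i, f (x i) b)
    simp only [this]
    rw [← mul_expect, expect_comm]
    have : ∀ b, 𝔼 x : Fin q → α, ∑ i, f (x i) b = q * 𝔼 a, f a b := fun b =>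
      expect_sum_samples q (fun a => f a b)
    simp only [this]
    rw [← mul_expect, hfp']
    ring
  -- The terms account for pairs of index pairs that coincide, share one coordinate, or share none.
  -- The degree bound `D` controls the middle one.
  have hX2 : 𝔼 x, X x ^ 2 ≤ q ^ 2 * p + 2 * q ^ 3 * (D / N * p) + q ^ 4 * p ^ 2 := by
    rw [expect_prod]
    have s1 : ∀ x : Fin q → α, 𝔼 y : Fin q → α, X (x, y) ^ 2 ≤
        q * 𝔼 b, (∑ i, f (x i) b) ^ 2 + q ^ 2 * (∑ i, 𝔼 b, f (x i) b) ^ 2 := fun x => by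
      rw [← expect_sum_comm]
      exact expect_sum_samples_sq_le q (fun b => ∑ i, f (x i) b)
    refine (expect_le_expect fun x _ => s1 x).trans ?_
    rw [expect_add_distrib, ← mul_expect, ← mul_expect, expect_comm]
    have s2 : ∀ b, 𝔼 x : Fin q → α, (∑ i, f (x i) b) ^ 2 ≤
        q * 𝔼 a, f a b + q ^ 2 * (𝔼 a, f a b) ^ 2 := fun b => by
      have := expect_sum_samples_sq_le q (fun a => f a b)
      simpa only [hf2] using this
    have s3 := expect_le_expect (s := univ) fun b _ => s2 b
    rw [expect_add_distrib, ← mul_expect, ← mul_expect, hfp'] at s3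
    have s4 := expect_sum_samples_sq_le q (fun a => 𝔼 b, f a b)
    rw [hfp] at s4
    have hq0 : (0 : ℝ) ≤ q := Nat.cast_nonneg q
    have s5 := s3.trans (add_le_add_right (mul_le_mul_of_nonneg_left hcol2 (sq_nonneg (q : ℝ))) _)
    have s6 := s4.trans (add_le_add_left (mul_le_mul_of_nonneg_left hrow2 hq0) _)
    have s7 := add_le_add (mul_le_mul_of_nonneg_left s5 hq0)
      (mul_le_mul_of_nonneg_left s6 (sq_nonneg (q : ℝ)))
    refine s7.trans (le_of_eq ?_)
    ring
  have hqF : 0 < (q : ℝ) ^ 2 * F.card := by nlinarith [sq_pos_of_pos hN0]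
  have hF0 : (0 : ℝ) < F.card := by
    rcases (Nat.cast_nonneg (α := ℝ) F.card).eq_or_lt with h | h
    · rw [← h] at hqF; simp at hqF
    · exact h
  have hq0 : (0 : ℝ) < q := by
    rcases (Nat.cast_nonneg (α := ℝ) q).eq_or_lt with h | h
    · rw [← h] at hqF; simp at hqF
    · exact h
  have hp0 : 0 < p := by positivity
  refine two_thirds_le_expect (X := X) (μ := q ^ 2 * p) (by positivity) hX ?_ P ?_
  · have hm : 100 ≤ (q : ℝ) ^ 2 * p := by
      rw [hp, mul_div_assoc', le_div_iff₀ (by positivity)]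
      exact hq
    -- With μ = q²p ≥ 100, the three terms of `hX2` are at most μ²/100, 2 · (3/20)μ² and μ², in
    -- total 1.31 μ² < (4/3)μ².
    have hDq : q ^ 3 * (D / N * p) ≤ 3 / 20 * ((q : ℝ) ^ 2 * p) ^ 2 := by
      have hD' : (D : ℝ) ^ 2 ≤ 2 * F.card := by exact_mod_cast hD
      have hz : (D / N : ℝ) ≤ 3 / 20 * (q * p) := by
        refine abs_le_of_sq_le_sq' ?_ (by positivity) |>.2
        have e1 : (D / N : ℝ) ^ 2 ≤ 2 * p := by
          rw [hp, div_pow, mul_div_assoc']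
          gcongr
        have e2 : (3 / 20 * (q * p)) ^ 2 = 9 / 400 * (q ^ 2 * p) * p := by ring
        rw [e2]
        nlinarith
      calc (q : ℝ) ^ 3 * (D / N * p) ≤ q ^ 3 * (3 / 20 * (q * p) * p) := by gcongr
        _ = _ := by ring
    nlinarith
  · intro x hx
    obtain ⟨j, -, hj⟩ := exists_ne_zero_of_sum_ne_zero hx
    obtain ⟨i, -, hi⟩ := exists_ne_zero_of_sum_ne_zero hj
    refine hP x i j ?_
    by_contra h
    simp [f, h] at hi

theorem uniform_map_apply [Nonempty Ω] {γ : Type*} [DecidableEq γ] (g : Ω → γ) (c : γ) :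
    (PMF.uniformOfFintype Ω).map g c =
      ENNReal.ofReal (𝔼 ω, if g ω = c then (1 : ℝ) else 0) := by
  have hΩ : (0 : ℝ) < Fintype.card Ω := by exact_mod_cast Fintype.card_pos
  rw [PMF.map_apply, tsum_fintype, Fintype.expect_eq_sum_div_card, ENNReal.ofReal_div_of_pos hΩ]
  simp only [PMF.uniformOfFintype_apply, eq_comm (a := c), sum_boole, ENNReal.ofReal_natCast]
  rw [← sum_filter, sum_const, nsmul_eq_mul, ENNReal.div_eq_inv_mul, mul_comm]

end Sampling

/-! ### Query programs -/

/-- Adaptive query algorithms with output in `α`. -/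
inductive Prog (n d : ℕ) (α : Type) : Type
  | pure (a : α) : Prog n d α
  | ask (q : Query n d) (next : q.Answer → Prog n d α) : Prog n d α

namespace Prog

variable {n d : ℕ} {α β : Type}

def bind : Prog n d α → (α → Prog n d β) → Prog n d β
  | pure a, f => f a
  | ask q next, f => ask q fun r => (next r).bind f

def eval (O : (q : Query n d) → q.Answer) : Prog n d α → α
  | pure a => a
  | ask q next => (next (O q)).eval O

def cost (O : (q : Query n d) → q.Answer) : Prog n d α → ℕ
  | pure _ => 0
  | ask q next => (next (O q)).cost O + 1

def toTree : Prog n d Bool → DecisionTree n d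
  | pure b => .output b
  | ask q next => .ask q fun r => (next r).toTree

/-- Run `f` on every element of a list. -/
def traverse (f : α → Prog n d β) : List α → Prog n d (List β)
  | [] => pure []
  | a :: l => (f a).bind fun b => (traverse f l).bind fun r => pure (b :: r)

variable (O : (q : Query n d) → q.Answer)

@[simp] theorem eval_pure (a : α) : (pure a : Prog n d α).eval O = a := rfl

@[simp] theorem cost_pure (a : α) : (pure a : Prog n d α).cost O = 0 := rfl

@[simp] theorem eval_ask (q : Query n d) (next : q.Answer → Prog n d α) :
    (ask q next).eval O = (next (O q)).eval O := rfl

@[simp] theorem cost_ask (q : Query n d) (next : q.Answer → Prog n d α) :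
    (ask q next).cost O = (next (O q)).cost O + 1 := rfl

@[simp] theorem eval_bind (p : Prog n d α) (f : α → Prog n d β) :
    (p.bind f).eval O = (f (p.eval O)).eval O := by
  induction p with
  | pure a => rfl
  | ask q next ih => exact ih (O q)

@[simp] theorem cost_bind (p : Prog n d α) (f : α → Prog n d β) :
    (p.bind f).cost O = p.cost O + (f (p.eval O)).cost O := by
  induction p with
  | pure a => simp [bind]
  | ask q next ih =>
    simp only [bind, cost_ask, eval_ask, ih]
    omega

@[simp] theorem verdict_toTree (p : Prog n d Bool) : p.toTree.verdict O = p.eval O := by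
  induction p with
  | pure a => rfl
  | ask q next ih => exact ih (O q)

@[simp] theorem queryCount_toTree (p : Prog n d Bool) : p.toTree.queryCount O = p.cost O := by
  induction p with
  | pure a => rfl
  | ask q next ih => exact congrArg (· + 1) (ih (O q))

@[simp] theorem eval_traverse (f : α → Prog n d β) (l : List α) :
    (traverse f l).eval O = l.map fun a => (f a).eval O := by
  induction l with
  | nil => rfl
  | cons a l ih => simp [traverse, ih]

theorem cost_traverse_le (f : α → Prog n d β) {c : ℕ} (hc : ∀ a, (f a).cost O ≤ c) (l : List α) :
    (traverse f l).cost O ≤ l.length * c := by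
  induction l with
  | nil => simp [traverse]
  | cons a l ih =>
    have := hc a
    simp only [traverse, cost_bind, cost_pure, List.length_cons, add_mul, one_mul]
    omega

end Prog

/-! ### The tester -/

/-- What is known about a vertex whose neighborhood has been explored: its label, the labels of its
in-neighbors, and its out-neighbors with their labels. -/
structure VertexInfo (n : ℕ) where
  label : Fin n
  inLabels : List (Fin n)
  outs : List (Fin n × Fin n)

section Tester

variable {n d : ℕ}

def askLabel (v : Fin n) : Prog n d (Fin n) := .ask (.label v) fun r => .pure r

def askInAt (v : Fin n) (i : Fin d) : Prog n d (Option (Fin n)) :=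
  .ask (.inNeighbor v i) fun r => .pure r

def askOutAt (v : Fin n) (i : Fin d) : Prog n d (Option (Fin n)) :=
  .ask (.outNeighbor v i) fun r => .pure r

def askIn (v : Fin n) : Prog n d (List (Fin n)) :=
  (Prog.traverse (askInAt v) (List.finRange d)).bind fun l => .pure (l.filterMap id)

def askOut (v : Fin n) : Prog n d (List (Fin n)) :=
  (Prog.traverse (askOutAt v) (List.finRange d)).bind fun l => .pure (l.filterMap id)

def exploreVertex (v : Fin n) : Prog n d (VertexInfo n) :=
  (askLabel v).bind fun a => (askIn v).bind fun ins => (Prog.traverse askLabel ins).bind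
    fun inLabels => (askOut v).bind fun outs => (Prog.traverse
      (fun u => (askLabel u).bind fun b => .pure (u, b)) outs).bind
        fun outs' => .pure ⟨a, inLabels, outs'⟩

/-- The explored vertices witness a violation. -/
def VertexInfo.Conflict (r s : VertexInfo n) : Prop :=
  r.label < s.label ∧ (∃ p ∈ r.outs, s.label < p.2) ∧ ∀ x ∈ s.inLabels, x < s.label → x < r.label

def allOuts (D : List (VertexInfo n)) : List (Fin n × Fin n) := D.flatMap VertexInfo.outs

/-- Starting from the vertices `D` with the labels `t`, …, `t + |D| - 1`, explore vertices in the
order of their labels, as long as they are out-neighbors of explored ones. -/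
def walk (t : ℕ) : ℕ → List (VertexInfo n) → Prog n d (List (VertexInfo n))
  | 0, D => .pure D
  | m + 1, D =>
    match (allOuts D).find? fun p => (p.2 : ℕ) = t + D.length with
    | none => .pure D
    | some p => (exploreVertex p.1).bind fun r => walk t m (r :: D)

/-- The vertex with the next label is not an out-neighbor of an explored vertex, although some
out-neighbor has a larger label. -/
def Gap (t : ℕ) (D : List (VertexInfo n)) : Prop :=
  (∀ p ∈ allOuts D, (p.2 : ℕ) ≠ t + D.length) ∧ ∃ p ∈ allOuts D, t + D.length < (p.2 : ℕ)

open Classical in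
/-- Search for a violation near `v`; `true` means that one has been found. -/
noncomputable def walkTest (m : ℕ) (v : Fin n) : Prog n d Bool :=
  (exploreVertex v).bind fun r => (walk r.label m [r]).bind fun D =>
    (Prog.traverse (fun p => exploreVertex p.1) (allOuts D)).bind fun L =>
      .pure (decide (Gap r.label D ∨ ∃ x ∈ D, ∃ y ∈ L, x.Conflict y))

open Classical in
/-- Search for a violation between two samples. -/
noncomputable def pairTest {q : ℕ} (x y : Fin q → Fin n) : Prog n d Bool :=
  (Prog.traverse exploreVertex (List.ofFn x)).bind fun L =>
    (Prog.traverse exploreVertex (List.ofFn y)).bind fun M =>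
      .pure (decide (∃ r ∈ L, ∃ s ∈ M, r.Conflict s))

/-- Accept unless a violation is found. -/
noncomputable def tester {q r : ℕ} (m : ℕ)
    (ω : ((Fin q → Fin n) × (Fin q → Fin n)) × (Fin r → Fin n)) : Prog n d Bool :=
  (pairTest ω.1.1 ω.1.2).bind fun a => (Prog.traverse (walkTest m) (List.ofFn ω.2)).bind fun b =>
    .pure (!(a || b.any id))

/-! ### Query complexity -/

variable (O : (q : Query n d) → q.Answer)

theorem length_askIn_le (v : Fin n) : ((askIn v).eval O).length ≤ d := by
  simp only [askIn, Prog.eval_bind, Prog.eval_pure]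
  refine (List.length_filterMap_le _ _).trans ?_
  simp

theorem length_askOut_le (v : Fin n) : ((askOut v).eval O).length ≤ d := by
  simp only [askOut, Prog.eval_bind, Prog.eval_pure]
  refine (List.length_filterMap_le _ _).trans ?_
  simp

theorem cost_exploreVertex_le (v : Fin n) : (exploreVertex v).cost O ≤ 4 * d + 1 := by
  have h0 : ∀ u : Fin n, (askLabel u : Prog n d (Fin n)).cost O = 1 := fun _ => rfl
  have h1 : (askIn v).cost O ≤ d := by
    have := Prog.cost_traverse_le O (askInAt v) (c := 1) (fun i => le_of_eq rfl) (List.finRange d)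
    simpa [askIn] using this
  have h2 : (askOut v).cost O ≤ d := by
    have := Prog.cost_traverse_le O (askOutAt v) (c := 1) (fun i => le_of_eq rfl) (List.finRange d)
    simpa [askOut] using this
  have h3 := Prog.cost_traverse_le O (askLabel : Fin n → Prog n d (Fin n)) (c := 1)
    (fun i => (h0 i).le) ((askIn v).eval O)
  have h4 := Prog.cost_traverse_le O
    (fun u => (askLabel u).bind fun b => (.pure (u, b) : Prog n d (Fin n × Fin n))) (c := 1)
    (fun i => by simp [h0]) ((askOut v).eval O)
  have h5 := length_askIn_le O v
  have h6 := length_askOut_le O v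
  have h7 := h0 v
  simp only [exploreVertex, Prog.cost_bind, Prog.cost_pure]
  omega

theorem length_outs_le (v : Fin n) : ((exploreVertex v).eval O).outs.length ≤ d := by
  simpa [exploreVertex] using length_askOut_le O v

theorem length_allOuts_le (D : List (VertexInfo n)) (hD : ∀ x ∈ D, x.outs.length ≤ d) :
    (allOuts D).length ≤ D.length * d := by
  induction D with
  | nil => simp [allOuts]
  | cons x D ih =>
    have h1 := ih fun y hy => hD y (by simp [hy])
    have h2 := hD x (by simp)
    simp only [allOuts, List.flatMap_cons, List.length_append, List.length_cons, add_mul,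
      one_mul] at h1 ⊢
    omega

theorem walk_bounds (t m : ℕ) : ∀ D : List (VertexInfo n), (∀ x ∈ D, x.outs.length ≤ d) →
    ((walk t m D).cost O ≤ m * (4 * d + 1) ∧ ((walk t m D).eval O).length ≤ D.length + m ∧
      ∀ x ∈ (walk t m D).eval O, x.outs.length ≤ d) := by
  induction m with
  | zero => intro D hD; simpa [walk] using hD
  | succ m ih =>
    intro D hD
    rw [walk]
    split
    · simpa using hD
    · rename_i p _
      obtain ⟨h1, h2, h3⟩ := ih ((exploreVertex p.1).eval O :: D) (by
        intro x hx
        rcases List.mem_cons.1 hx with rfl | hx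
        · exact length_outs_le O p.1
        · exact hD x hx)
      have h4 := cost_exploreVertex_le O p.1
      simp only [Prog.cost_bind, Prog.eval_bind, List.length_cons] at h1 h2 h3 ⊢
      refine ⟨?_, by omega, h3⟩
      rw [add_mul]
      omega

theorem cost_walkTest_le (m : ℕ) (v : Fin n) :
    (walkTest m v).cost O ≤ (m + 1) * (d + 1) * (4 * d + 1) := by
  have h1 := cost_exploreVertex_le O v
  obtain ⟨h2, h3, h4⟩ := walk_bounds O ((exploreVertex v).eval O).label m
    [(exploreVertex v).eval O] (by simpa using length_outs_le O v)
  have h5 := length_allOuts_le _ h4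
  have h6 := Prog.cost_traverse_le O (fun p : Fin n × Fin n => exploreVertex p.1)
    (fun p => cost_exploreVertex_le O p.1) (allOuts ((walk ((exploreVertex v).eval O).label m
      [(exploreVertex v).eval O]).eval O))
  simp only [walkTest, Prog.cost_bind, Prog.cost_pure, List.length_singleton] at *
  have h7 := Nat.mul_le_mul_right (4 * d + 1) (h5.trans (Nat.mul_le_mul_right d h3))
  nlinarith

theorem cost_tester_le {q r : ℕ} (m : ℕ)
    (ω : ((Fin q → Fin n) × (Fin q → Fin n)) × (Fin r → Fin n)) :
    (tester m ω).cost O ≤ (4 * d + 1) * (2 * q + r * ((m + 1) * (d + 1))) := by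
  have h1 := Prog.cost_traverse_le O exploreVertex (cost_exploreVertex_le O) (List.ofFn ω.1.1)
  have h2 := Prog.cost_traverse_le O exploreVertex (cost_exploreVertex_le O) (List.ofFn ω.1.2)
  have h3 := Prog.cost_traverse_le O (walkTest m) (cost_walkTest_le O m) (List.ofFn ω.2)
  simp only [List.length_ofFn] at h1 h2 h3
  simp only [tester, pairTest, Prog.cost_bind, Prog.cost_pure]
  nlinarith

end Tester

/-! ### What the tester finds -/

section Verdict

variable {n d : ℕ} {G : Digraph (Fin n)} (num : Equiv.Perm (Fin n)) (N : NeighborOrder G)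

/-- Under the degree bound, `d` indexed queries reveal the whole neighbor list. -/
theorem mem_filterMap_getElem? {α : Type*} {l : List α} (hl : l.length ≤ d) (a : α) :
    a ∈ ((List.finRange d).map fun i : Fin d => l[(i : ℕ)]?).filterMap id ↔ a ∈ l := by
  simp only [List.mem_filterMap, List.mem_map, List.mem_finRange, true_and, id]
  constructor
  · rintro ⟨_, ⟨i, rfl⟩, hi⟩
    exact List.mem_of_getElem? hi
  · intro ha
    obtain ⟨i, hi, rfl⟩ := List.getElem_of_mem ha
    exact ⟨_, ⟨⟨i, hi.trans_le hl⟩, rfl⟩, by simp [hi]⟩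

theorem Enumerates.length_eq {V : Type*} {l : List V} {s : Set V} (h : Enumerates l s) :
    l.length = s.ncard := by
  classical
  have : s = (l.toFinset : Set V) := by
    ext v
    simp [h.2 v]
  rw [this, Set.ncard_coe_finset, List.toFinset_card_of_nodup h.1]

/-- The result of exploring the vertex `v`. -/
noncomputable def info (d : ℕ) (v : Fin n) : VertexInfo n :=
  (exploreVertex v).eval (oracle d N num)

theorem info_label (v : Fin n) : (info num N d v).label = num v := by
  simp only [info, exploreVertex, Prog.eval_bind, Prog.eval_pure]
  rfl

variable {N} (hG : DegreeAtMost d G)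

include hG

theorem mem_askIn (v u : Fin n) : u ∈ (askIn v).eval (oracle d N num) ↔ G.Adj u v := by
  have h := N.inList_spec v
  have := mem_filterMap_getElem? (h.length_eq.trans_le (hG v).1) u
  rw [h.2] at this
  simp only [askIn, Prog.eval_bind, Prog.eval_pure, Prog.eval_traverse]
  exact this

theorem mem_askOut (v u : Fin n) : u ∈ (askOut v).eval (oracle d N num) ↔ G.Adj v u := by
  have h := N.outList_spec v
  have := mem_filterMap_getElem? (h.length_eq.trans_le (hG v).2) u
  rw [h.2] at this
  simp only [askOut, Prog.eval_bind, Prog.eval_pure, Prog.eval_traverse]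
  exact this

theorem mem_info_inLabels (v x : Fin n) :
    x ∈ (info num N d v).inLabels ↔ ∃ u, G.Adj u v ∧ num u = x := by
  simp only [info, exploreVertex, Prog.eval_bind, Prog.eval_pure, Prog.eval_traverse,
    List.mem_map, mem_askIn num hG]
  rfl

theorem mem_info_outs (v : Fin n) (p : Fin n × Fin n) :
    p ∈ (info num N d v).outs ↔ G.Adj v p.1 ∧ p.2 = num p.1 := by
  have h : ∀ u : Fin n, (askLabel u).eval (oracle d N num) = num u := fun _ => rfl
  simp only [info, exploreVertex, Prog.eval_bind, Prog.eval_pure, Prog.eval_traverse,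
    List.mem_map, mem_askOut num hG, h]
  constructor
  · rintro ⟨u, hu, rfl⟩
    exact ⟨hu, rfl⟩
  · rintro ⟨h1, h2⟩
    exact ⟨p.1, h1, Prod.ext rfl h2.symm⟩

/-- A violation splits into label comparisons between the out-neighborhood of `a` and the
in-neighborhood of `b`, so exploring both vertices separately decides it. -/
theorem conflict_info_iff (a b : Fin n) :
    (info num N d a).Conflict (info num N d b) ↔ Violates G num a b := by
  simp only [VertexInfo.Conflict, Violates, info_label, mem_info_inLabels num hG,
    mem_info_outs num hG]
  refine and_congr Iff.rfl (and_congr ?_ ?_)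
  · constructor
    · rintro ⟨p, ⟨h1, h2⟩, h3⟩
      exact ⟨p.1, h1, h2 ▸ h3⟩
    · rintro ⟨c, h1, h2⟩
      exact ⟨(c, num c), ⟨h1, rfl⟩, h2⟩
  · constructor
    · intro h x hx
      exact h _ ⟨x, hx, rfl⟩
    · rintro h _ ⟨x, hx, rfl⟩
      exact h x hx

theorem eval_pairTest {q : ℕ} (x y : Fin q → Fin n) :
    (pairTest x y).eval (oracle d N num) = true ↔ ∃ i j, Violates G num (x i) (y j) := by
  have h : ∀ v, (exploreVertex v).eval (oracle d N num) = info num N d v := fun _ => rfl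
  simp only [pairTest, Prog.eval_bind, Prog.eval_traverse, Prog.eval_pure, h, decide_eq_true_eq,
    List.mem_map, List.mem_ofFn]
  constructor
  · rintro ⟨_, ⟨_, ⟨i, rfl⟩, rfl⟩, _, ⟨_, ⟨j, rfl⟩, rfl⟩, hc⟩
    exact ⟨i, j, (conflict_info_iff num hG _ _).1 hc⟩
  · rintro ⟨i, j, hv⟩
    exact ⟨_, ⟨_, ⟨i, rfl⟩, rfl⟩, _, ⟨_, ⟨j, rfl⟩, rfl⟩, (conflict_info_iff num hG _ _).2 hv⟩

omit hG in
/-- The list `D` describes the vertices with the labels `t`, …, `t + |D| - 1`, each of which except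
the first is an out-neighbor of an earlier one. -/
structure IsSegment (N : NeighborOrder G) (d t : ℕ) (D : List (VertexInfo n)) : Prop where
  pos : 0 < D.length
  mem_iff : ∀ R, R ∈ D ↔ ∃ u, t ≤ (num u : ℕ) ∧ (num u : ℕ) < t + D.length ∧ R = info num N d u
  exists_pred : ∀ u, t < (num u : ℕ) → (num u : ℕ) < t + D.length →
    ∃ x, t ≤ (num x : ℕ) ∧ num x < num u ∧ G.Adj x u

theorem IsSegment.mem_allOuts {t : ℕ} {D : List (VertexInfo n)} (h : IsSegment num N d t D)
    (p : Fin n × Fin n) : p ∈ allOuts D ↔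
      ∃ u, t ≤ (num u : ℕ) ∧ (num u : ℕ) < t + D.length ∧ G.Adj u p.1 ∧ p.2 = num p.1 := by
  simp only [allOuts, List.mem_flatMap, h.mem_iff]
  constructor
  · rintro ⟨_, ⟨u, h1, h2, rfl⟩, hp⟩
    exact ⟨u, h1, h2, (mem_info_outs num hG u p).1 hp⟩
  · rintro ⟨u, h1, h2, hp⟩
    exact ⟨_, ⟨u, h1, h2, rfl⟩, (mem_info_outs num hG u p).2 hp⟩

/-- The walk keeps its label interval contiguous and stops short only when no explored vertex points
to the next label. -/
theorem eval_walk (t m : ℕ) : ∀ D : List (VertexInfo n), IsSegment num N d t D →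
    ∃ D', (walk t m D).eval (oracle d N num) = D' ∧ IsSegment num N d t D' ∧
      D'.length ≤ D.length + m ∧
      (D'.length = D.length + m ∨ ∀ p ∈ allOuts D', (p.2 : ℕ) ≠ t + D'.length) := by
  induction m with
  | zero => exact fun D hD => ⟨D, rfl, hD, by simp, by simp⟩
  | succ m ih =>
    intro D hD
    rw [walk]
    split
    · rename_i hnone
      refine ⟨D, rfl, hD, by omega, Or.inr fun p hp => ?_⟩
      simpa using List.find?_eq_none.1 hnone p hp
    · rename_i p hsome
      have hp := List.mem_of_find?_eq_some hsome
      have hlab : (p.2 : ℕ) = t + D.length := by simpa using List.find?_some hsome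
      obtain ⟨u, hu1, hu2, hu3, hu4⟩ := (hD.mem_allOuts num hG p).1 hp
      rw [hu4] at hlab
      have hinfo : (exploreVertex p.1).eval (oracle d N num) = info num N d p.1 := rfl
      have huniq : ∀ v, (num v : ℕ) = t + D.length → v = p.1 := fun v hv =>
        num.injective (Fin.ext (hv.trans hlab.symm))
      obtain ⟨D', h1, h2, h3, h4⟩ := ih (info num N d p.1 :: D) (by
        refine ⟨by simp, fun R => ?_, fun v hv1 hv2 => ?_⟩
        · rw [List.mem_cons, hD.mem_iff, List.length_cons]
          constructor
          · rintro (rfl | ⟨v, hv1, hv2, rfl⟩)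
            · exact ⟨p.1, by omega, by omega, rfl⟩
            · exact ⟨v, hv1, by omega, rfl⟩
          · rintro ⟨v, hv1, hv2, rfl⟩
            by_cases hv : (num v : ℕ) = t + D.length
            · exact Or.inl (by rw [huniq v hv])
            · exact Or.inr ⟨v, hv1, by omega, rfl⟩
        · rw [List.length_cons] at hv2
          by_cases hv : (num v : ℕ) = t + D.length
          · exact ⟨u, hu1, by rw [Fin.lt_def]; omega, huniq v hv ▸ hu3⟩
          · exact hD.exists_pred v hv1 (by omega))
      rw [List.length_cons] at h3 h4
      refine ⟨D', ?_, h2, by omega, ?_⟩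
      · rw [Prog.eval_bind, hinfo, h1]
      · exact h4.imp_left fun h => by omega

theorem exists_walk (m : ℕ) (v : Fin n) : ∃ D : List (VertexInfo n),
    IsSegment num N d (num v) D ∧ D.length ≤ m + 1 ∧
    (D.length = m + 1 ∨ ∀ p ∈ allOuts D, (p.2 : ℕ) ≠ num v + D.length) ∧
    ((walkTest m v).eval (oracle d N num) = true ↔ Gap (num v) D ∨
      ∃ a b, (num v : ℕ) ≤ num a ∧ (num a : ℕ) < num v + D.length ∧
        (∃ x, (num v : ℕ) ≤ num x ∧ (num x : ℕ) < num v + D.length ∧ G.Adj x b) ∧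
        Violates G num a b) := by
  have h : ∀ v, (exploreVertex v).eval (oracle d N num) = info num N d v := fun _ => rfl
  have hseg : IsSegment num N d (num v) [info num N d v] := by
    refine ⟨by simp, fun R => ?_, fun u h1 h2 => by simp at h2; omega⟩
    simp only [List.mem_singleton, List.length_singleton]
    constructor
    · rintro rfl
      exact ⟨v, le_rfl, by omega, rfl⟩
    · rintro ⟨u, h1, h2, rfl⟩
      have : u = v := num.injective (Fin.ext (by omega))
      rw [this]
  obtain ⟨D, h1, h2, h3, h4⟩ := eval_walk num hG (num v) m _ hseg
  rw [List.length_singleton, add_comm 1 m] at h3 h4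
  refine ⟨D, h2, h3, h4, ?_⟩
  simp only [walkTest, Prog.eval_bind, Prog.eval_traverse, Prog.eval_pure, h, info_label, h1,
    decide_eq_true_eq]
  refine or_congr Iff.rfl ?_
  simp only [h2.mem_iff, List.mem_map, h2.mem_allOuts num hG]
  constructor
  · rintro ⟨_, ⟨a, ha1, ha2, rfl⟩, _, ⟨p, ⟨x, hx1, hx2, hx3, hx4⟩, rfl⟩, hc⟩
    exact ⟨a, p.1, ha1, ha2, ⟨x, hx1, hx2, hx3⟩, (conflict_info_iff num hG _ _).1 hc⟩
  · rintro ⟨a, b, ha1, ha2, ⟨x, hx1, hx2, hx3⟩, hv⟩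
    exact ⟨_, ⟨a, ha1, ha2, rfl⟩, _, ⟨(b, num b), ⟨x, hx1, hx2, hx3, rfl⟩, rfl⟩,
      (conflict_info_iff num hG _ _).2 hv⟩

theorem eval_walkTest_eq_false (hK : ∀ a b, ¬ Violates G num a b) (m : ℕ) (v : Fin n) :
    (walkTest m v).eval (oracle d N num) = false := by
  obtain ⟨D, h1, h2, h3, h4⟩ := exists_walk (N := N) num hG m v
  rw [← Bool.not_eq_true, h4]
  rintro (⟨g1, p, g2, g3⟩ | ⟨a, b, -, -, -, hv⟩)
  · obtain ⟨u, hu1, hu2, hu3, hu4⟩ := (h1.mem_allOuts num hG p).1 g2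
    have hn : (num v : ℕ) + D.length < n := g3.trans p.2.2
    obtain ⟨b, hb⟩ : ∃ b, (num b : ℕ) = num v + D.length := ⟨num.symm ⟨_, hn⟩, by simp⟩
    -- A gap is itself a violation: `b` carries the next label, `u` points beyond it, and no
    -- in-neighbor of `b` lies in the explored interval.
    refine hK u b ⟨by rw [Fin.lt_def]; omega, ⟨p.1, hu3, by rw [Fin.lt_def, ← hu4]; omega⟩, ?_⟩
    intro x hx hlt
    rw [Fin.lt_def] at hlt ⊢
    by_contra hcon
    exact g1 (b, num b) ((h1.mem_allOuts num hG _).2 ⟨x, by omega, by omega, hx, rfl⟩) hb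
  · exact hK a b hv

/-- Each explored vertex after `v` has an in-neighbor in the interval, so `b` cannot be one of them.
The out-neighbor of `v` beyond `b` rules out an early stop, as that would be a gap. Finally, if the
right end of a violation starting in the interval had an in-neighbor there, the walk would have
explored it and seen the conflict. -/
theorem Violates.far_of_walkTest {m : ℕ} {v b : Fin n} (hv : Violates G num v b)
    (hw : (walkTest m v).eval (oracle d N num) ≠ true) :
    (num v : ℕ) + m < num b ∧ ∀ u c, num v ≤ num u → (num u : ℕ) ≤ num v + m →
      Violates G num u c → ∀ x, G.Adj x c → num x < num c → num x < num v := by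
  obtain ⟨D, h1, h2, h3, h4⟩ := exists_walk (N := N) num hG m v
  have hpos := h1.pos
  rw [ne_eq, h4, not_or] at hw
  obtain ⟨hgap, hconf⟩ := hw
  obtain ⟨v1, ⟨c, hc, v2⟩, v3⟩ := hv
  rw [Fin.lt_def] at v1 v2
  have hb : (num v : ℕ) + D.length ≤ num b := by
    by_contra hcon
    obtain ⟨x, hx1, hx2, hx3⟩ := h1.exists_pred b v1 (by omega)
    have := v3 x hx3 hx2
    rw [Fin.lt_def] at this
    omega
  have hlen : D.length = m + 1 := by
    refine h3.resolve_right fun h => hgap ⟨h, (c, num c), ?_, ?_⟩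
    · exact (h1.mem_allOuts num hG _).2 ⟨v, le_rfl, by omega, hc, rfl⟩
    · simp only
      omega
  refine ⟨by omega, fun u e hu1 hu2 hue x hx hlt => ?_⟩
  have hxu := hue.2.2 x hx hlt
  by_contra hcon
  rw [Fin.lt_def] at hxu hcon
  exact hconf ⟨u, e, hu1, by omega, ⟨x, by omega, by omega, hx⟩, hue⟩

/-- Violations whose left ends are close to each other are exchangeable in one direction. -/
theorem Violates.exchange {m : ℕ} {v v' b b' : Fin n} (hv : Violates G num v b)
    (hv' : Violates G num v' b') (hw : (walkTest m v).eval (oracle d N num) ≠ true)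
    (h : num v ≤ num v') (h' : (num v' : ℕ) ≤ num v + m) :
    Violates G num v' b ∨ Violates G num v b' := by
  obtain ⟨f1, f2⟩ := hv.far_of_walkTest num hG hw
  obtain ⟨v1, ⟨c, hc, v2⟩, v3⟩ := hv
  have w := hv'
  obtain ⟨w1, ⟨c', hc', w2⟩, w3⟩ := w
  -- If `b` precedes `c'`, the edge `v' → c'` jumps over `b`, which lies beyond `v'` because the
  -- walk missed it. Otherwise `b' < c' ≤ b < c` in label order, and `v → c` jumps over `b'`.
  rcases lt_or_ge (num b) (num c') with hlt | hge
  · exact Or.inl ⟨by rw [Fin.lt_def]; omega, ⟨c', hc', hlt⟩, fun x hx hxb =>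
      (v3 x hx hxb).trans_le h⟩
  · exact Or.inr ⟨h.trans_lt w1, ⟨c, hc, (w2.trans_le hge).trans v2⟩, fun x hx hxb =>
      f2 v' b' h h' hv' x hx hxb⟩

theorem eval_tester_eq_true (hK : ∀ a b, ¬ Violates G num a b) {q r : ℕ} (m : ℕ)
    (ω : ((Fin q → Fin n) × (Fin q → Fin n)) × (Fin r → Fin n)) :
    (tester m ω).eval (oracle d N num) = true := by
  have h : (pairTest ω.1.1 ω.1.2).eval (oracle d N num) = false := by
    rw [← Bool.not_eq_true, eval_pairTest num hG]
    rintro ⟨i, j, hv⟩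
    exact hK _ _ hv
  simp [tester, h, eval_walkTest_eq_false num hG hK]

theorem eval_tester_eq_false_iff {q r : ℕ} (m : ℕ)
    (ω : ((Fin q → Fin n) × (Fin q → Fin n)) × (Fin r → Fin n)) :
    (tester m ω).eval (oracle d N num) = false ↔ (∃ i j, Violates G num (ω.1.1 i) (ω.1.2 j)) ∨
      ∃ i, (walkTest m (ω.2 i)).eval (oracle d N num) = true := by
  rw [← eval_pairTest (d := d) (N := N) num hG]
  simp only [tester, Prog.eval_bind, Prog.eval_traverse, Prog.eval_pure]
  cases (pairTest ω.1.1 ω.1.2).eval (oracle d N num) <;> simp [List.mem_ofFn]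

end Verdict

/-! ### From distance to rejection probability -/

section Analysis

open Finset BigOperators

variable {n d : ℕ} {G : Digraph (Fin n)} {num : Equiv.Perm (Fin n)}

/-- For a matching of maximum size, an uncovered related pair could be added; thus its endpoints
cover `R`. -/
theorem exists_maximal_matching {α : Type*} [Fintype α] [DecidableEq α] (R : α → α → Prop) :
    ∃ M : Finset (α × α), (∀ e ∈ M, R e.1 e.2) ∧ Set.InjOn Prod.fst (M : Set (α × α)) ∧
      Set.InjOn Prod.snd (M : Set (α × α)) ∧
      ∀ a b, R a b → a ∈ M.image Prod.fst ∨ b ∈ M.image Prod.snd := by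
  classical
  let S : Finset (Finset (α × α)) := univ.filter fun M => (∀ e ∈ M, R e.1 e.2) ∧
    Set.InjOn Prod.fst (M : Set (α × α)) ∧ Set.InjOn Prod.snd (M : Set (α × α))
  obtain ⟨M, hM, hmax⟩ := S.exists_max_image card ⟨∅, by simp [S]⟩
  obtain ⟨-, m1, m2, m3⟩ := mem_filter.1 hM
  refine ⟨M, m1, m2, m3, fun a b hab => ?_⟩
  by_contra hcon
  push Not at hcon
  obtain ⟨ha, hb⟩ := hcon
  have hnot : (a, b) ∉ M := fun h => ha (mem_image_of_mem Prod.fst h)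
  have hins : insert (a, b) M ∈ S := by
    refine mem_filter.2 ⟨mem_univ _, ?_, ?_, ?_⟩
    · intro e he
      rcases mem_insert.1 he with rfl | he
      · exact hab
      · exact m1 e he
    · rw [coe_insert, Set.injOn_insert (by simpa using hnot)]
      refine ⟨m2, ?_⟩
      rintro ⟨e, he, h⟩
      exact ha (mem_image.2 ⟨e, he, h⟩)
    · rw [coe_insert, Set.injOn_insert (by simpa using hnot)]
      refine ⟨m3, ?_⟩
      rintro ⟨e, he, h⟩
      exact hb (mem_image.2 ⟨e, he, h⟩)
  have := hmax _ hins
  rw [card_insert_of_notMem hnot] at this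
  omega

/-- A matching whose edges can be exchanged within the classes of a partition into at most `s`
classes generates a bipartite graph with many edges and small degrees. -/
theorem exists_dense_of_exchange {α : Type*} [DecidableEq α] (R : α → α → Prop)
    (M : Finset (α × α)) (hfst : Set.InjOn Prod.fst (M : Set (α × α)))
    (hsnd : Set.InjOn Prod.snd (M : Set (α × α))) (c : α → ℕ) (s : ℕ)
    (hc : ∀ e ∈ M, c e.1 < s)
    (hR : ∀ e ∈ M, ∀ e' ∈ M, c e.1 = c e'.1 → R e.1 e'.2 ∨ R e'.1 e.2) :
    ∃ F : Finset (α × α), (∀ e ∈ F, R e.1 e.2) ∧ M.card ^ 2 ≤ s * (2 * F.card) ∧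
      (∀ a, (F.filter fun e => e.1 = a).card ^ 2 ≤ 2 * F.card) ∧
      (∀ b, (F.filter fun e => e.2 = b).card ^ 2 ≤ 2 * F.card) := by
  classical
  -- `Q` consists of the pairs of matching edges in one class. By exchange each lies in `P` or has
  -- its swap there, so `P` is at least half of `Q`; the matching property makes `P → F` injective.
  set Q : Finset ((α × α) × (α × α)) := (M ×ˢ M).filter fun x => c x.1.1 = c x.2.1 with hQ
  set P : Finset ((α × α) × (α × α)) := Q.filter fun x => R x.1.1 x.2.2 with hP
  set F : Finset (α × α) := P.image fun x => (x.1.1, x.2.2) with hF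
  have hmemQ : ∀ x, x ∈ Q ↔ (x.1 ∈ M ∧ x.2 ∈ M) ∧ c x.1.1 = c x.2.1 := fun x => by
    rw [hQ, mem_filter, mem_product]
  have hPF : F.card = P.card := by
    refine card_image_of_injOn fun x hx y hy hxy => ?_
    have hx' := (hmemQ x).1 (mem_filter.1 hx).1
    have hy' := (hmemQ y).1 (mem_filter.1 hy).1
    have h := Prod.ext_iff.1 hxy
    exact Prod.ext (hfst hx'.1.1 hy'.1.1 h.1) (hsnd hx'.1.2 hy'.1.2 h.2)
  have hQP : Q.card ≤ 2 * F.card := by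
    have hsub : Q ⊆ P ∪ P.image Prod.swap := by
      intro x hx
      obtain ⟨⟨h1, h2⟩, h3⟩ := (hmemQ x).1 hx
      rcases hR _ h1 _ h2 h3 with h | h
      · exact mem_union_left _ (mem_filter.2 ⟨hx, h⟩)
      · refine mem_union_right _ (mem_image.2 ⟨x.swap, mem_filter.2 ⟨?_, h⟩, by simp⟩)
        exact (hmemQ _).2 ⟨⟨h2, h1⟩, h3.symm⟩
    have h1 := card_le_card hsub
    have h2 := card_union_le P (P.image Prod.swap)
    have h3 : (P.image Prod.swap).card ≤ P.card := card_image_le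
    omega
  let m : ℕ → ℕ := fun i => (M.filter fun e => c e.1 = i).card
  have hm : ∀ i, m i ^ 2 ≤ Q.card := by
    intro i
    rw [sq, ← card_product]
    refine card_le_card fun x hx => ?_
    obtain ⟨h1, h2⟩ := mem_product.1 hx
    obtain ⟨h1, h3⟩ := mem_filter.1 h1
    obtain ⟨h2, h4⟩ := mem_filter.1 h2
    exact (hmemQ x).2 ⟨⟨h1, h2⟩, h3.trans h4.symm⟩
  have hmemF : ∀ e, e ∈ F → ∃ x : (α × α) × (α × α), x.1 ∈ M ∧ x.2 ∈ M ∧ c x.1.1 = c x.2.1 ∧ x.1.1 = e.1 ∧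
      x.2.2 = e.2 ∧ R x.1.1 x.2.2 := by
    intro e he
    obtain ⟨x, hx, rfl⟩ := mem_image.1 he
    obtain ⟨hx, hr⟩ := mem_filter.1 hx
    obtain ⟨⟨h1, h2⟩, h3⟩ := (hmemQ x).1 hx
    exact ⟨x, h1, h2, h3, rfl, rfl, hr⟩
  refine ⟨F, ?_, ?_, ?_, ?_⟩
  · intro e he
    obtain ⟨x, -, -, -, h1, h2, h3⟩ := hmemF e he
    rwa [← h1, ← h2]
  · have h1 : M.card = ∑ i ∈ range s, m i :=
      card_eq_sum_card_fiberwise fun e he => by simpa using hc e he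
    have h2 : Q.card = ∑ i ∈ range s, m i ^ 2 := by
      rw [card_eq_sum_card_fiberwise (f := fun x => c x.1.1) (t := range s)
        fun x hx => by simpa using hc _ ((hmemQ x).1 hx).1.1]
      refine sum_congr rfl fun i _ => ?_
      rw [sq, ← card_product]
      congr 1
      ext x
      simp only [mem_filter, mem_product, hmemQ]
      constructor
      · rintro ⟨⟨⟨h1, h2⟩, h3⟩, h4⟩
        exact ⟨⟨h1, h4⟩, h2, h3 ▸ h4⟩
      · rintro ⟨⟨h1, h4⟩, h2, h5⟩
        exact ⟨⟨⟨h1, h2⟩, h4.trans h5.symm⟩, h4⟩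
    -- Cauchy-Schwarz over the class sizes `m i`, whose squares sum to `Q.card`.
    have h3 := sq_sum_le_card_mul_sum_sq (s := range s) (f := m)
    rw [card_range, ← h1, ← h2] at h3
    exact h3.trans (Nat.mul_le_mul_left _ hQP)
  · intro a
    -- Degrees are bounded by a class size, whose square is at most `Q.card`.
    have : (F.filter fun e => e.1 = a).card ≤ m (c a) := by
      refine (card_le_card (t := (M.filter fun e => c e.1 = c a).image fun e => (a, e.2)) ?_).trans
        card_image_le
      intro e he
      obtain ⟨he, hea⟩ := mem_filter.1 he
      obtain ⟨x, h1, h2, h3, h4, h5, -⟩ := hmemF e he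
      exact mem_image.2 ⟨x.2, mem_filter.2 ⟨h2, by rw [← h3, h4, hea]⟩, Prod.ext hea.symm h5⟩
    exact (Nat.pow_le_pow_left this 2).trans ((hm _).trans hQP)
  · intro b
    rcases (F.filter fun e => e.2 = b).eq_empty_or_nonempty with h0 | ⟨e₀, he₀⟩
    · simp [h0]
    obtain ⟨he₀, hb⟩ := mem_filter.1 he₀
    obtain ⟨x₀, -, g2, -, -, g5, -⟩ := hmemF e₀ he₀
    have : (F.filter fun e => e.2 = b).card ≤ m (c x₀.2.1) := by
      refine (card_le_card
        (t := (M.filter fun e => c e.1 = c x₀.2.1).image fun e => (e.1, b)) ?_).trans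
        card_image_le
      intro e he
      obtain ⟨he, heb⟩ := mem_filter.1 he
      obtain ⟨x, h1, h2, h3, h4, h5, -⟩ := hmemF e he
      have hx : x.2 = x₀.2 := hsnd h2 g2 (h5.trans (heb.trans (hb.symm.trans g5.symm)))
      exact mem_image.2 ⟨x.1, mem_filter.2 ⟨h1, by rw [h3, hx]⟩, Prod.ext h4 heb.symm⟩
    exact (Nat.pow_le_pow_left this 2).trans ((hm _).trans hQP)

/-- If `G` is far from having the DFS numbering `num`, then many vertices start walks that find a
violation, or there is a large matching of violations that are not found by walks. -/
theorem IsFarFromDFS.card_le {ε : ℝ} (h : IsFarFromDFS d ε G num) (hG : DegreeAtMost d G)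
    (W : Finset (Fin n)) (M : Finset (Fin n × Fin n))
    (hM : ∀ a b, Violates G num a b ∧ a ∉ W → a ∈ M.image Prod.fst ∨ b ∈ M.image Prod.snd) :
    ε * n < 4 * (d + 1) ^ 2 * (W.card + 2 * M.card) := by
  obtain ⟨G', h1, h2, h3⟩ := exists_repair_of_cover (num := num) hG (W ∪ M.image Prod.fst)
    (M.image Prod.snd) (by
      intro a b hab
      by_cases ha : a ∈ W
      · exact Or.inl (mem_union_left _ ha)
      · exact (hM a b ⟨hab, ha⟩).imp_left fun h => mem_union_right _ h)
  refine (h G' h1 h2).trans_le ?_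
  have h4 : (W ∪ M.image Prod.fst).card + (M.image Prod.snd).card ≤ W.card + 2 * M.card := by
    have e1 := card_union_le W (M.image Prod.fst)
    have e2 : (M.image Prod.fst).card ≤ M.card := card_image_le
    have e3 : (M.image Prod.snd).card ≤ M.card := card_image_le
    omega
  exact_mod_cast h3.trans (Nat.mul_le_mul_left _ h4)

/-- Farness gives `W.card + 2 * M.card > δ * n`. Either successful starting points `W` have density
at least δ/2 and 6/δ walks hit one, or `M` has at least δn/4 edges and the pair test succeeds. -/
theorem two_thirds_le_of_far (hn : 0 < n) {ε δ : ℝ} (hδ : δ = ε / (4 * (d + 1) ^ 2))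
    (hδ0 : 0 < δ) (N : NeighborOrder G) (hG : DegreeAtMost d G)
    (hfar : IsFarFromDFS d ε G num) {k q r : ℕ} (hk0 : 0 < k) (hkn : k ≤ n) (hk : n ≤ k ^ 3)
    (hq : 80 * k / δ ≤ q) (hr : 6 / δ ≤ r)
    (P : ((Fin q → Fin n) × (Fin q → Fin n)) × (Fin r → Fin n) → Prop) [DecidablePred P]
    (hP : ∀ ω, P ω ↔ (tester k ω).eval (oracle d N num) = false) :
    (2 / 3 : ℝ) ≤ 𝔼 ω, if P ω then (1 : ℝ) else 0 := by
  classical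
  have : Nonempty (Fin n) := ⟨⟨0, hn⟩⟩
  have hn' : (0 : ℝ) < n := by exact_mod_cast hn
  have hk' : (0 : ℝ) < k := by exact_mod_cast hk0
  let W : Finset (Fin n) := univ.filter fun v => (walkTest k v).eval (oracle d N num) = true
  obtain ⟨M, m1, m2, m3, m4⟩ :=
    exists_maximal_matching fun a b => Violates G num a b ∧ a ∉ W
  have hcard := hfar.card_le hG W M m4
  have hδn : δ * n < W.card + 2 * M.card := by
    rw [hδ, div_mul_eq_mul_div, div_lt_iff₀ (by positivity), mul_comm _ (4 * ((d : ℝ) + 1) ^ 2)]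
    exact hcard
  rw [expect_prod]
  by_cases hW : δ * n / 2 ≤ W.card
  · have hit := two_thirds_le_hit W r (by
      rw [Fintype.card_fin]
      rw [div_le_iff₀ hδ0] at hr
      have := mul_le_mul_of_nonneg_left hW (Nat.cast_nonneg (α := ℝ) r)
      nlinarith) (fun x => ∃ i, x i ∈ W) fun x i hi => ⟨i, hi⟩
    rw [← Fintype.expect_const (ι := (Fin q → Fin n) × (Fin q → Fin n)) (2 / 3 : ℝ)]
    refine expect_le_expect fun x _ => hit.trans (expect_le_expect fun y _ => ?_)
    by_cases hy : ∃ i, y i ∈ W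
    · have : P (x, y) := by
        rw [hP, eval_tester_eq_false_iff num hG]
        obtain ⟨i, hi⟩ := hy
        exact Or.inr ⟨i, (mem_filter.1 hi).2⟩
      simp [hy, this]
    · simp only [hy, if_false]
      split_ifs <;> norm_num
  · have hMcard : δ * n / 4 ≤ M.card := by
      push Not at hW
      linarith
    obtain ⟨F, f1, f2, f3, f4⟩ := exists_dense_of_exchange (Violates G num) M m2 m3
      (fun a => (num a : ℕ) / k) (n / k + 1)
      (fun e _ => Nat.lt_succ_of_le (Nat.div_le_div_right (num e.1).2.le)) (by
        intro e he e' he' hc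
        have hclose : ∀ u v : Fin n, (num u : ℕ) / k = (num v : ℕ) / k →
            (num v : ℕ) ≤ num u + k := by
          intro u v huv
          have e1 := Nat.div_add_mod (num u : ℕ) k
          have e2 := Nat.div_add_mod (num v : ℕ) k
          have e3 := Nat.mod_lt (num v : ℕ) hk0
          rw [huv] at e1
          omega
        have hnot : ∀ e ∈ M, (walkTest k e.1).eval (oracle d N num) ≠ true := fun e he h =>
          (m1 e he).2 (mem_filter.2 ⟨mem_univ _, h⟩)
        rcases le_total (num e.1) (num e'.1) with hle | hle
        · exact ((m1 e he).1.exchange num hG (m1 e' he').1 (hnot e he) hle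
            (hclose _ _ hc)).symm
        · exact (m1 e' he').1.exchange num hG (m1 e he).1 (hnot e' he') hle
            (hclose _ _ hc.symm))
    -- The extra class holds the incomplete last block; `k ≤ n` absorbs it.
    have hs : ((n / k + 1 : ℕ) : ℝ) * k ≤ 2 * n := by
      have := Nat.div_mul_le_self n k
      have : (n / k + 1) * k ≤ 2 * n := by rw [add_mul]; omega
      exact_mod_cast this
    have hbig : 100 * (n : ℝ) ^ 2 ≤ (q : ℝ) ^ 2 * F.card := by
      have g1 : (M.card : ℝ) ^ 2 ≤ ((n / k + 1 : ℕ) : ℝ) * (2 * F.card) := by exact_mod_cast f2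
      have g2 : (δ * n / 4) ^ 2 ≤ (M.card : ℝ) ^ 2 := by gcongr
      have g3 : (δ * n / 4) ^ 2 * k ≤ 2 * n * (2 * F.card) := by
        calc (δ * n / 4) ^ 2 * k ≤ ((n / k + 1 : ℕ) : ℝ) * (2 * F.card) * k := by
              gcongr
              exact g2.trans g1
          _ = ((n / k + 1 : ℕ) : ℝ) * k * (2 * F.card) := by ring
          _ ≤ 2 * n * (2 * F.card) := by gcongr
      have g4 : δ ^ 2 * n * k / 64 ≤ F.card := by
        have : n * (δ ^ 2 * n * k / 64) ≤ n * (F.card : ℝ) := by nlinarith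
        exact le_of_mul_le_mul_left this hn'
      have g5 : (n : ℝ) ≤ k ^ 3 := by exact_mod_cast hk
      calc 100 * (n : ℝ) ^ 2 = 100 * n * n := by ring
        _ ≤ 100 * n * k ^ 3 := by gcongr
        -- The factor 80 is chosen so that 80²/64 = 100, the constant of the birthday bound.
        _ = (80 * k / δ) ^ 2 * (δ ^ 2 * n * k / 64) := by
          field_simp
          ring
        _ ≤ (q : ℝ) ^ 2 * F.card := by gcongr
    have birthday := two_thirds_le_birthday F (Nat.sqrt (2 * F.card)) q
      (fun a => Nat.le_sqrt'.2 (f3 a)) (fun b => Nat.le_sqrt'.2 (f4 b)) (Nat.sqrt_le' _)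
      (by rwa [Fintype.card_fin]) (fun x => ∃ i j, (x.1 i, x.2 j) ∈ F) fun x i j h => ⟨i, j, h⟩
    refine birthday.trans (expect_le_expect fun x _ => ?_)
    by_cases hx : ∃ i j, (x.1 i, x.2 j) ∈ F
    · have : ∀ y, P (x, y) := by
        intro y
        rw [hP, eval_tester_eq_false_iff num hG]
        obtain ⟨i, j, hij⟩ := hx
        exact Or.inl ⟨i, j, f1 _ hij⟩
      simp [hx, this]
    · simp only [hx, if_false]
      refine expect_nonneg fun y _ => ?_
      split_ifs <;> norm_num

end Analysis

/-! ### The theorem -/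

/-- The algorithm for `n` vertices and distance parameter `ε`. -/
noncomputable def dfsTester (d n : ℕ) (ε : ℝ) : RandomizedAlgorithm n d :=
  if h : 0 < n then
    haveI : Nonempty (Fin n) := ⟨⟨0, h⟩⟩
    let δ : ℝ := ε / (4 * (d + 1) ^ 2)
    let k : ℕ := ⌈(n : ℝ) ^ (1 / 3 : ℝ)⌉₊
    (PMF.uniformOfFintype (((Fin ⌈80 * k / δ⌉₊ → Fin n) × (Fin ⌈80 * k / δ⌉₊ → Fin n)) ×
      (Fin ⌈6 / δ⌉₊ → Fin n))).map fun ω => (tester k ω).toTree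
  else PMF.pure (.output true)

end DFSTesting

open DFSTesting in
theorem mainTheorem5 (d : ℕ) :
    ∃ C : ℝ, 0 < C ∧ ∃ A : (n : ℕ) → ℝ → RandomizedAlgorithm n d,
      ∀ (n : ℕ) (ε : ℝ), 0 < ε → ε < 1 →
        ∀ (G : Digraph (Fin n)) (num : Equiv.Perm (Fin n)) (N : NeighborOrder G),
          DegreeAtMost d G →
            (∀ T ∈ (A n ε).support,
              (T.queryCount (oracle d N num) : ℝ) ≤ C * ((n : ℝ) ^ (1 / 3 : ℝ) / ε)) ∧
            (IsDFSNumbering G num →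
              RandomizedAlgorithm.verdict (A n ε) (oracle d N num) true = 1) ∧
            (IsFarFromDFS d ε G num →
              2 / 3 ≤ RandomizedAlgorithm.verdict (A n ε) (oracle d N num) false) := by
  -- 1408 = 176 · 2 · 4: the sample counts give 176, rounding up the cube root gives 2, and 1/δ =
  -- 4(d + 1)²/ε gives 4 and two factors d + 1.
  refine ⟨1408 * (4 * d + 1) * (d + 1) ^ 3, by positivity, dfsTester d, ?_⟩
  intro n ε hε hε1 G num N hG
  by_cases hn : 0 < n
  · have : Nonempty (Fin n) := ⟨⟨0, hn⟩⟩
    have hn1 : (1 : ℝ) ≤ n := by exact_mod_cast hn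
    obtain ⟨δ, hδ⟩ : ∃ δ : ℝ, δ = ε / (4 * (d + 1) ^ 2) := ⟨_, rfl⟩
    obtain ⟨k, hk⟩ : ∃ k : ℕ, k = ⌈(n : ℝ) ^ (1 / 3 : ℝ)⌉₊ := ⟨_, rfl⟩
    have hδ0 : 0 < δ := by rw [hδ]; positivity
    have hA : dfsTester d n ε = (PMF.uniformOfFintype (((Fin ⌈80 * k / δ⌉₊ → Fin n) ×
        (Fin ⌈80 * k / δ⌉₊ → Fin n)) × (Fin ⌈6 / δ⌉₊ → Fin n))).map
          fun ω => (tester k ω).toTree := by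
      rw [dfsTester, dif_pos hn]
      subst hδ hk
      rfl
    have hroot1 : (1 : ℝ) ≤ (n : ℝ) ^ (1 / 3 : ℝ) := Real.one_le_rpow hn1 (by norm_num)
    have hroot3 : ((n : ℝ) ^ (1 / 3 : ℝ)) ^ 3 = n := by
      rw [← Real.rpow_natCast, ← Real.rpow_mul (by positivity)]
      norm_num
    have hkge : (n : ℝ) ^ (1 / 3 : ℝ) ≤ k := hk ▸ Nat.le_ceil _
    have hkle : (k : ℝ) ≤ 2 * (n : ℝ) ^ (1 / 3 : ℝ) := by
      have := Nat.ceil_lt_add_one (a := (n : ℝ) ^ (1 / 3 : ℝ)) (by positivity)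
      rw [← hk] at this
      linarith
    have hk1 : (1 : ℝ) ≤ k := hroot1.trans hkge
    have hverdict : ∀ b : Bool, RandomizedAlgorithm.verdict (dfsTester d n ε) (oracle d N num) b =
        (PMF.uniformOfFintype (((Fin ⌈80 * k / δ⌉₊ → Fin n) × (Fin ⌈80 * k / δ⌉₊ → Fin n)) ×
          (Fin ⌈6 / δ⌉₊ → Fin n))).map (fun ω => (tester k ω).eval (oracle d N num)) b := by
      intro b
      rw [RandomizedAlgorithm.verdict, hA, PMF.map_comp]
      simp only [Function.comp_def, Prog.verdict_toTree]
    refine ⟨fun T hT => ?_, fun hdfs => ?_, fun hfar => ?_⟩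
    · rw [hA, PMF.mem_support_map_iff] at hT
      obtain ⟨ω, -, rfl⟩ := hT
      rw [Prog.queryCount_toTree]
      have hcost := cost_tester_le (oracle d N num) k ω
      generalize hq : ⌈80 * k / δ⌉₊ = q at ω hcost ⊢
      generalize hr : ⌈6 / δ⌉₊ = r at ω hcost ⊢
      have hδ1 : δ ≤ 1 := by
        rw [hδ, div_le_one (by positivity)]
        nlinarith [Nat.cast_nonneg (α := ℝ) d]
      have hq' : (q : ℝ) ≤ 81 * k / δ := by
        have h1 := Nat.ceil_lt_add_one (a := 80 * k / δ) (by positivity)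
        rw [hq] at h1
        have h2 : 1 ≤ k / δ := by rw [le_div_iff₀ hδ0]; linarith
        have h3 : 81 * k / δ = 80 * k / δ + k / δ := by ring
        linarith
      have hr' : (r : ℝ) ≤ 7 / δ := by
        have h1 := Nat.ceil_lt_add_one (a := 6 / δ) (by positivity)
        rw [hr] at h1
        have h2 : 1 ≤ 1 / δ := by rw [le_div_iff₀ hδ0]; linarith
        have h3 : 7 / δ = 6 / δ + 1 / δ := by ring
        linarith
      have hcost' : ((tester k ω).cost (oracle d N num) : ℝ) ≤
          (4 * d + 1) * (2 * q + r * ((k + 1) * (d + 1))) := by exact_mod_cast hcost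
      refine hcost'.trans ?_
      calc (4 * (d : ℝ) + 1) * (2 * q + r * ((k + 1) * (d + 1)))
          ≤ (4 * d + 1) * (2 * (81 * k / δ) + 7 / δ * ((k + k) * (d + 1))) := by gcongr
        _ = (4 * d + 1) * ((162 + 14 * (d + 1)) * (k / δ)) := by ring
        _ ≤ (4 * d + 1) * ((176 * (d + 1)) * (k / δ)) := by
          gcongr
          linarith [Nat.cast_nonneg (α := ℝ) d]
        _ ≤ (4 * d + 1) * ((176 * (d + 1)) * (2 * (n : ℝ) ^ (1 / 3 : ℝ) / δ)) := by gcongr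
        _ = _ := by
          rw [hδ]
          field_simp
          ring
    · rw [hverdict, uniform_map_apply]
      have := eval_tester_eq_true (N := N) num hG (isDFSNumbering_iff.1 hdfs)
        (q := ⌈80 * k / δ⌉₊) (r := ⌈6 / δ⌉₊) k
      simp [this]
    · have h := two_thirds_le_of_far hn hδ hδ0 N hG hfar (by exact_mod_cast hk1)
        (hk ▸ Nat.ceil_le.2 ((Real.rpow_le_rpow_of_exponent_le hn1 (by norm_num)).trans_eq
          (Real.rpow_one _)))
        (by
          have : (n : ℝ) ≤ k ^ 3 := by
            rw [← hroot3]
            gcongr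
          exact_mod_cast this)
        (Nat.le_ceil _) (Nat.le_ceil _)
        (fun ω => (tester k ω).eval (oracle d N num) = false) fun ω => Iff.rfl
      rw [hverdict, uniform_map_apply]
      refine le_trans ?_ (ENNReal.ofReal_le_ofReal h)
      rw [ENNReal.ofReal_div_of_pos (by norm_num)]
      norm_num
  -- Here the query bound is zero, so the algorithm must accept at once; this is correct because the
  -- empty graph has no violations.
  · obtain rfl : n = 0 := by omega
    have hA : dfsTester d 0 ε = PMF.pure (.output true) := by simp [dfsTester]
    have hdfs : IsDFSNumbering G num := isDFSNumbering_iff.2 fun a => a.elim0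
    refine ⟨fun T hT => ?_, fun _ => ?_, fun hfar => ?_⟩
    · rw [hA, PMF.support_pure, Set.mem_singleton_iff] at hT
      simp [hT, DecisionTree.queryCount]
    · simp [hA, RandomizedAlgorithm.verdict, PMF.pure_map, DecisionTree.verdict]
    · have := hfar G hG hdfs
      simp at this
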